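/- Let $L_p=L_p([0,1])$ with real or complex scalars. Let $G$ be a finitely generated group with the left-invariant word metric $d_S(x,y)=|x^{-1}y|_S$ of a finite symmetric generating set $S$. A map $\psi:G\to X$ into a Banach space $X$ is called equivariant if it is the orbit map of a vector $v\in X$ under an affine isometric action of $G$ on $X$, i.e. $\psi(x)=\pi(x)v+f(x)$ for some homomorphism $\pi$ from $G$ to the group of linear isometric automorphisms of $X$ and some $f:G\to X$ with $f(xy)=\pi(x)f(y)+f(x)$ for all $x,y\in G$. Let $\alpha_p^\#(G)\in[0,\infty]$ be the supremum of all $\alpha\ge 0$ for which there are a Lipschitz equivariant map $\psi:G\to L_p$ and a constant $c>0$ such that $\|\psi(x)-\psi(y)\|_p\ge c\, d_S(x,y)^{\alpha}$ for all distinct $x,y\in G$. Then for every real $p\ge 1$ and every finite symmetric generating set $S$ of the free group $\mathbb F_2$ on two generators, $$\alpha_p^\#(\mathbb F_2)=\max\left\{\tfrac12,\tfrac1p\right\}.$$ Moreover, $\mathbb F_2$ is not amenable, and for every $2\le p<\infty$ the number $\tfrac12$ is the sharp threshold in the implication "large $\alpha_p^\#$ implies amenable": every finitely generated group $G$ with $\alpha_p^\#(G)>\frac12$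 (for some finite symmetric generating set) is amenable, and $\frac12$ is the least $t\in[0,\infty]$ such that $\alpha_p^\#(G)>t$ implies that $G$ is amenable for all finitely generated groups $G$. (A group $G$ is amenable if there is a left-invariant finitely additive probability measure on the set of all subsets of $G$.) -/

import Mathlib

open MeasureTheory
open scoped ENNReal NNReal

noncomputable section

namespace Compression

section Group

variable {G : Type*} [Group G]

/-- `S` is a finite symmetric set of generators of the group `G`. -/
structure IsSymmGenSet (S : Set G) : Prop where
  finite : S.Finite
  symm : ∀ s ∈ S, s⁻¹ ∈ S
  closure_eq_top : Subgroup.closure S = ⊤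

/-- Word length: the least `n` such that `g` is a product of `n` elements of `S`. -/
def wordLength (S : Set G) (g : G) : ℕ :=
  sInf {n : ℕ | ∃ l : List G, (∀ s ∈ l, s ∈ S) ∧ l.prod = g ∧ l.length = n}

/-- The left-invariant word metric `d(x, y) = |x⁻¹ y|` induced by `S`. -/
def wordDist (S : Set G) (x y : G) : ℕ := wordLength S (x⁻¹ * y)

/-- The (discrete) group `G` is amenable: there is a left-invariant finitely additive probability
measure defined on all subsets of `G`. -/
def IsAmenable (G : Type*) [Group G] : Prop :=
  ∃ m : Set G → ℝ≥0∞, m Set.univ = 1 ∧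
    (∀ A B : Set G, Disjoint A B → m (A ∪ B) = m A + m B) ∧
    ∀ (g : G) (A : Set G), m ((fun x => g * x) '' A) = m A

end Group

section Equivariant

variable (𝕜 : Type*) [RCLike 𝕜] {G : Type*} [Group G]
  (X : Type*) [NormedAddCommGroup X] [NormedSpace 𝕜 X]

variable {X} in
/-- `f` is a 1-cocycle with respect to the action `π` of `G` on `X` by linear isometric
automorphisms. -/
def IsOneCocycle (π : G →* (X ≃ₗᵢ[𝕜] X)) (f : G → X) : Prop :=
  ∀ x y : G, f (x * y) = π x (f y) + f x

variable {X} in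
/-- `ψ : G → X` is equivariant: it is the orbit map of a vector `v` under an affine isometric
action `w ↦ π x w + f x` of `G` on `X`. -/
def IsEquivariantMap (ψ : G → X) : Prop :=
  ∃ (π : G →* (X ≃ₗᵢ[𝕜] X)) (f : G → X) (v : X),
    IsOneCocycle 𝕜 π f ∧ ∀ x : G, ψ x = π x v + f x

/-- There are an equivariant map `ψ : G → X`, Lipschitz for the word metric of `S`, and a `c > 0`
with `‖ψ x - ψ y‖ ≥ c * d(x, y) ^ α` for all `x ≠ y`.
(For `x = y` and `α > 0` the inequality is trivial; leaving `x = y` out only avoids `0 ^ 0 = 1`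
when `α = 0`.) -/
def HasEquivariantCompression (S : Set G) (α : ℝ≥0) : Prop :=
  ∃ ψ : G → X, IsEquivariantMap 𝕜 ψ ∧
    (∃ L : ℝ, ∀ x y : G, ‖ψ x - ψ y‖ ≤ L * (wordDist S x y : ℝ)) ∧
    ∃ c : ℝ, 0 < c ∧ ∀ x y : G, x ≠ y →
      c * (wordDist S x y : ℝ) ^ (α : ℝ) ≤ ‖ψ x - ψ y‖

/-- The equivariant compression exponent of `G` (with the word metric of `S`) in `X`, the supremum
of all `α ≥ 0` as above, computed in `[0, ∞]`. -/
def equivariantCompressionExponent (S : Set G) : ℝ≥0∞ :=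
  ⨆ (α : ℝ≥0) (_ : HasEquivariantCompression 𝕜 X S α), (α : ℝ≥0∞)

/-- The equivariant `L_p` compression exponent; `L_p` is `L_p([0, 1])` with Lebesgue measure and
scalars in `𝕜`. -/
def lpEquivariantCompressionExponent (p : ℝ≥0∞) [Fact (1 ≤ p)] (S : Set G) : ℝ≥0∞ :=
  equivariantCompressionExponent 𝕜 (Lp 𝕜 p (volume : Measure unitInterval)) S

end Equivariant

end Compression

end

namespace Compression

/-! ### Criteria for amenability, and the non-amenability of the free group. -/

section Amenability

/-! Upper bound. Let `q = min(p, 2)`; `L_p` is smooth of power type `q`. Run a random walk whose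
steps are products of two independent uniform elements of `T = S ∪ {1}`. Along this walk a 1-cocycle
is the difference of two martingales, one of them in reversed time, so its `q`-th moment after `n`
steps is at most `C n` (`IsOneCocycle.exists_pathMean_le`). If `G` is not amenable, the squared `ℓ²`
norm of the law at time `n` is at most `ρ ^ n` with `ρ < 1` (`isAmenable_or_exponential_decay`), so
for suitable `k` the walk at time `k r` cannot sit in a ball of radius `r` with probability `1/2`.
But `‖b x‖ ≥ c |x|^α` with `α q > 1` and Markov's inequality would put it there for large `r`. So
compression above `1/q = max(1/2, 1/p)` forces amenability, and the free group is not amenable.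

Lower bound. The signed edges on the path from `1` to `x` in the Cayley tree form a cocycle whose
support has as many elements as `x` has letters. Send the edges to vectors of `L_p` permuted by the
group: disjointly supported indicators give norm `|x|^(1/p)`, and independent identically
distributed variables give at least a constant times `|x|^(1/2)` when `p ≥ 2`. Both models live on
atomless σ-finite standard Borel spaces, whose `L_p` is isometric to `L_p([0, 1])`
(`nonempty_lpEquiv_unitInterval`). The same bound makes `1/2` sharp for `p ≥ 2`. -/

theorem summable_of_support_finite {α : Type*} {f : α → ℝ} (hf : f.support.Finite) : Summable f :=
  summable_of_hasFiniteSupport hf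

variable {G : Type*} [Group G]

/-- Almost invariant finitely additive probability measures have an invariant limit point. -/
theorem isAmenable_of_almost_invariant_measure {S : Set G} (hS : IsSymmGenSet S)
    (h : ∀ ε : ℝ≥0∞, 0 < ε → ∃ m : Set G → ℝ≥0∞, m Set.univ = 1 ∧
      (∀ A B : Set G, Disjoint A B → m (A ∪ B) = m A + m B) ∧
      ∀ s ∈ S, ∀ A : Set G, m ((fun x => s * x) '' A) ≤ m A + ε) : IsAmenable G := by
  have hpos : ∀ n : ℕ, (0 : ℝ≥0∞) < (n : ℝ≥0∞)⁻¹ := fun n => by simp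
  choose m m_univ m_add m_inv using fun n : ℕ => h _ (hpos n)
  -- Compactness of `[0, ∞]` gives limits along a free ultrafilter for all sets simultaneously, and
  -- such limits preserve finite additivity.
  let U : Ultrafilter ℕ := Filter.hyperfilter ℕ
  have hU : (U : Filter ℕ) ≤ Filter.atTop := by
    rw [← Nat.cofinite_eq_atTop]; exact Filter.hyperfilter_le_cofinite
  have hlim : ∀ A : Set G, ∃ a : ℝ≥0∞, Filter.Tendsto (fun n => m n A) U (nhds a) := fun A =>
    ⟨_, (U.map fun n => m n A).le_nhds_lim⟩
  choose M hM using hlim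
  have hinv : ∀ s ∈ S, ∀ A : Set G, M ((fun x => s * x) '' A) ≤ M A := by
    intro s hs A
    have h0 : Filter.Tendsto (fun n : ℕ => m n A + (n : ℝ≥0∞)⁻¹) U (nhds (M A + 0)) :=
      (hM A).add (ENNReal.tendsto_inv_nat_nhds_zero.mono_left hU)
    rw [add_zero] at h0
    exact le_of_tendsto_of_tendsto' (hM _) h0 fun n => m_inv n s hs A
  have hinv' : ∀ s ∈ S, ∀ A : Set G, M ((fun x => s * x) '' A) = M A := by
    intro s hs A
    refine le_antisymm (hinv s hs A) ?_
    have := hinv s⁻¹ (hS.symm s hs) ((fun x => s * x) '' A)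
    rw [Set.image_image] at this
    simpa only [inv_mul_cancel_left, Set.image_id'] using this
  refine ⟨M, ?_, ?_, ?_⟩
  · refine tendsto_nhds_unique (hM Set.univ) ?_
    simp [m_univ]
  · intro A B hAB
    refine tendsto_nhds_unique (hM _) ?_
    simp_rw [m_add _ A B hAB]
    exact (hM A).add (hM B)
  · intro g
    have hg : g ∈ Subgroup.closure S := by simp [hS.closure_eq_top]
    induction hg using Subgroup.closure_induction with
    | mem s hs => exact hinv' s hs
    | one => intro A; simp
    | mul x y _ _ hx hy =>
      intro A
      rw [← hy A, ← hx ((fun z => y * z) '' A), Set.image_image]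
      simp only [mul_assoc]
    | inv x _ hx =>
      intro A
      rw [← hx, Set.image_image]
      simp only [mul_inv_cancel_left, Set.image_id']

/-- Almost invariant finitely supported vectors in `ℓ²(G)` give amenability. -/
theorem isAmenable_of_almost_invariant_vectors {S : Set G} (hS : IsSymmGenSet S)
    (h : ∀ ε : ℝ, 0 < ε → ∃ u : G → ℝ, u.support.Finite ∧ 0 < ∑' g, u g ^ 2 ∧
      ∀ s ∈ S, ∑' g, (u (s * g) - u g) ^ 2 ≤ ε * ∑' g, u g ^ 2) : IsAmenable G := by
  refine isAmenable_of_almost_invariant_measure hS fun δ hδ => ?_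
  obtain ⟨δ', hδ'0, hδ'⟩ : ∃ δ' : ℝ, 0 < δ' ∧ ENNReal.ofReal δ' ≤ δ := by
    rcases eq_or_ne δ ∞ with rfl | hne
    · exact ⟨1, one_pos, le_top⟩
    · exact ⟨δ.toReal, ENNReal.toReal_pos hδ.ne' hne, by rw [ENNReal.ofReal_toReal hne]⟩
  -- The error `∑ D` below splits into one part of size at most `η` (as `ε = η²`) and one equal to
  -- `2η`.
  set η := δ' / 3 with hη
  have hη0 : 0 < η := by positivity
  obtain ⟨u, hu, hpos, hinv⟩ := h (η ^ 2) (by positivity)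
  set N := ∑' g, u g ^ 2 with hN
  have hu2 : Summable fun g => u g ^ 2 := by
    refine summable_of_support_finite (hu.subset fun g hg => ?_)
    intro h0; simp [h0] at hg
  let w : G → ℝ≥0∞ := fun g => ENNReal.ofReal (u g ^ 2 / N)
  have hw : ∑' g, w g = 1 := by
    rw [← ENNReal.ofReal_tsum_of_nonneg (fun g => by positivity) (hu2.div_const N), tsum_div_const,
      ← hN, div_self hpos.ne', ENNReal.ofReal_one]
  refine ⟨fun A => ∑' g, A.indicator w g, by simpa using hw, fun A B hAB => ?_,
    fun s hs A => ?_⟩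
  · beta_reduce
    rw [← ENNReal.tsum_add, Set.indicator_union_of_disjoint hAB]
  · have hus : Summable fun g => u (s * g) ^ 2 := (Equiv.mulLeft s).summable_iff.mpr hu2
    have husN : ∑' g, u (s * g) ^ 2 = N := (Equiv.mulLeft s).tsum_eq fun g => u g ^ 2
    have hd : Summable fun g => (u (s * g) - u g) ^ 2 := by
      refine Summable.of_nonneg_of_le (fun g => sq_nonneg _) (fun g => ?_)
        ((hus.add hu2).mul_left 2)
      nlinarith [sq_nonneg (u (s * g) + u g)]
    -- Young's inequality with weight `η` bounds `u(sg)² - u(g)²`, factored as a difference times a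
    -- sum, by `N * D g`.
    let D : G → ℝ := fun g => ((u (s * g) - u g) ^ 2 / η + η * (u (s * g) ^ 2 + u g ^ 2)) / N
    have hD0 : ∀ g, 0 ≤ D g := fun g => by positivity
    have hDs : Summable D := ((hd.div_const η).add ((hus.add hu2).mul_left η)).div_const N
    have hDsum : ∑' g, D g ≤ δ' := by
      simp only [D]
      rw [tsum_div_const, (hd.div_const η).tsum_add ((hus.add hu2).mul_left η), tsum_div_const,
        tsum_mul_left, hus.tsum_add hu2, husN, ← hN, div_le_iff₀ hpos]
      have : (∑' g, (u (s * g) - u g) ^ 2) / η ≤ η * N := by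
        rw [div_le_iff₀ hη0]; nlinarith [hinv s hs]
      rw [hη] at *
      linarith
    have hle : ∀ g, w (s * g) ≤ w g + ENNReal.ofReal (D g) := by
      intro g
      rw [← ENNReal.ofReal_add (by positivity) (hD0 g)]
      refine ENNReal.ofReal_le_ofReal ?_
      simp only [D]
      rw [← add_div]
      refine div_le_div_of_nonneg_right ?_ hpos.le
      have key : (u (s * g) - u g) * (u (s * g) + u g) ≤
          (u (s * g) - u g) ^ 2 / η + η * (u (s * g) ^ 2 + u g ^ 2) := by
        have e1 : (u (s * g) - u g) ^ 2 / η + η * (u (s * g) ^ 2 + u g ^ 2) -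
            (u (s * g) - u g) * (u (s * g) + u g) =
            ((u (s * g) - u g) / η - (u (s * g) + u g) / 2) ^ 2 * η +
            η * (u (s * g) - u g) ^ 2 / 4 + η * (u (s * g) ^ 2 + u g ^ 2) / 2 := by
          field_simp; ring
        have : 0 ≤ ((u (s * g) - u g) / η - (u (s * g) + u g) / 2) ^ 2 * η +
            η * (u (s * g) - u g) ^ 2 / 4 + η * (u (s * g) ^ 2 + u g ^ 2) / 2 := by positivity
        linarith
      nlinarith
    calc ∑' g, ((fun x => s * x) '' A).indicator w g
        = ∑' g, ((fun x => s * x) '' A).indicator w (s * g) :=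
          ((Equiv.mulLeft s).tsum_eq _).symm
      _ ≤ ∑' g, (A.indicator w g + ENNReal.ofReal (D g)) := by
          refine ENNReal.tsum_le_tsum fun g => ?_
          by_cases hg : g ∈ A
          · have : s * g ∈ (fun x => s * x) '' A := ⟨g, hg, rfl⟩
            simpa [this, hg] using hle g
          · have : s * g ∉ (fun x => s * x) '' A := by simpa using hg
            rw [Set.indicator_of_notMem this]
            exact zero_le
      _ = ∑' g, A.indicator w g + ENNReal.ofReal (∑' g, D g) := by
          rw [ENNReal.tsum_add, ENNReal.ofReal_tsum_of_nonneg hD0 hDs]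
      _ ≤ _ := by
          gcongr
          exact (ENNReal.ofReal_le_ofReal hDsum).trans hδ'

theorem IsAmenable.of_mulEquiv {H : Type*} [Group H] (e : G ≃* H) (hG : IsAmenable G) :
    IsAmenable H := by
  obtain ⟨m, m_univ, m_add, m_inv⟩ := hG
  refine ⟨fun A => m (e ⁻¹' A), by simpa using m_univ, fun A B hAB => ?_, fun g A => ?_⟩
  · beta_reduce
    rw [Set.preimage_union, m_add _ _ (hAB.preimage e)]
  · beta_reduce
    rw [← m_inv (e.symm g) (e ⁻¹' A)]
    congr 1
    ext x
    constructor
    · rintro ⟨a, ha, hx⟩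
      refine ⟨e.symm a, by simpa using ha, ?_⟩
      apply e.injective
      simpa using hx
    · rintro ⟨a, ha, rfl⟩
      exact ⟨e a, ha, by simp⟩

-- Paradoxical decomposition: for each generator `a`, the words starting with `a` and a translate of
-- those starting with `a⁻¹` cover the group. The four sets of words are disjoint, so invariance
-- would give `2 ≤ 1`.
open FreeGroup in
theorem not_isAmenable_freeGroup : ¬ IsAmenable (FreeGroup (Fin 2)) := by
  rintro ⟨m, m_univ, m_add, m_inv⟩
  have mono : ∀ A B : Set (FreeGroup (Fin 2)), A ⊆ B → m A ≤ m B := by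
    intro A B hAB
    rw [← Set.union_sdiff_cancel hAB, m_add _ _ Set.disjoint_sdiff_right]
    exact le_self_add
  have subadd : ∀ A B : Set (FreeGroup (Fin 2)), m (A ∪ B) ≤ m A + m B := by
    intro A B
    rw [← Set.union_sdiff_self, m_add _ _ Set.disjoint_sdiff_right]
    gcongr
    exact mono _ _ Set.sdiff_subset
  have key : ∀ i : Fin 2, 1 ≤ m (startsWith (i, true)) + m (startsWith (i, false)) := by
    intro i
    rw [← m_inv (mk [(i, true)]) (startsWith (i, false)), ← m_univ]
    refine (mono _ _ fun g _ => ?_).trans (subadd _ _)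
    by_cases hg : (mk [(i, true)])⁻¹ * g ∈ startsWith (i, false)
    · exact Or.inr ⟨_, hg, mul_inv_cancel_left _ _⟩
    · left
      simpa only [mul_inv_cancel_left] using startsWith_mk_mul (w := (i, true)) _ hg
  have hdis : ∀ w w' : Fin 2 × Bool, w ≠ w' → Disjoint (startsWith w) (startsWith w') :=
    fun w w' hw => startsWith.disjoint_iff_ne.mpr hw
  have h2 : m (startsWith (0, true) ∪ startsWith (0, false) ∪
      (startsWith (1, true) ∪ startsWith (1, false))) ≤ 1 := m_univ ▸ mono _ _ (Set.subset_univ _)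
  rw [m_add _ _ (by simp [Set.disjoint_union_left, Set.disjoint_union_right]),
    m_add _ _ (hdis _ _ (by simp)), m_add _ _ (hdis _ _ (by simp))] at h2
  have h3 : (1 + 1 : ℝ≥0∞) ≤ 1 := (add_le_add (key 0) (key 1)).trans h2
  norm_num at h3

end Amenability

/-! ### Averages over words of independent uniform letters. -/

section PathMean

open scoped BigOperators

variable {J : Type*} [Fintype J]

/-- The mean of `Φ` over all words of length `n` in the letters `J`. -/
noncomputable def pathMean : ℕ → (List J → ℝ) → ℝ
  | 0, Φ => Φ []
  | n + 1, Φ => 𝔼 j, pathMean n fun l => Φ (j :: l)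

theorem pathMean_mono {n : ℕ} {Φ Ψ : List J → ℝ} (h : ∀ l, Φ l ≤ Ψ l) :
    pathMean n Φ ≤ pathMean n Ψ := by
  induction n generalizing Φ Ψ with
  | zero => exact h []
  | succ n ih => exact Finset.expect_le_expect fun j _ => ih fun l => h _

theorem pathMean_add (n : ℕ) (Φ Ψ : List J → ℝ) :
    pathMean n (fun l => Φ l + Ψ l) = pathMean n Φ + pathMean n Ψ := by
  induction n generalizing Φ Ψ with
  | zero => rfl
  | succ n ih => simp only [pathMean, ih, Finset.expect_add_distrib]

theorem pathMean_mul_left (n : ℕ) (c : ℝ) (Φ : List J → ℝ) :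
    pathMean n (fun l => c * Φ l) = c * pathMean n Φ := by
  induction n generalizing Φ with
  | zero => rfl
  | succ n ih => simp only [pathMean, ih, Finset.mul_expect]

theorem pathMean_const [Nonempty J] (n : ℕ) (c : ℝ) :
    pathMean n (fun _ : List J => c) = c := by
  induction n with
  | zero => rfl
  | succ n ih => simp only [pathMean, ih, Fintype.expect_const]

theorem pathMean_sum {ι : Type*} (n : ℕ) (s : Finset ι) (Φ : ι → List J → ℝ) :
    pathMean n (fun l => ∑ i ∈ s, Φ i l) = ∑ i ∈ s, pathMean n (Φ i) := by
  induction n generalizing Φ with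
  | zero => rfl
  | succ n ih => simp only [pathMean, ih, Finset.expect_sum_comm]

theorem pathMean_expect {ι : Type*} (n : ℕ) (s : Finset ι) (Φ : ι → List J → ℝ) :
    pathMean n (fun l => 𝔼 i ∈ s, Φ i l) = 𝔼 i ∈ s, pathMean n (Φ i) := by
  simp only [Finset.expect_eq_sum_div_card, div_eq_inv_mul, pathMean_mul_left, pathMean_sum]

theorem pathMean_nonneg {n : ℕ} {Φ : List J → ℝ} (h : ∀ l, 0 ≤ Φ l) : 0 ≤ pathMean n Φ := by
  induction n generalizing Φ with
  | zero => exact h []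
  | succ n ih => exact Finset.expect_nonneg fun j _ => ih fun l => h _

/-- The squared differences over all ordered pairs add up to `2 |J|²` times the variance, and one
pair contributes at most the whole sum. -/
theorem sq_sub_le_expect (x : J → ℝ) (j k : J) :
    (x j - x k) ^ 2 ≤ 2 * (Fintype.card J : ℝ) ^ 2 * ((𝔼 i, x i ^ 2) - (𝔼 i, x i) ^ 2) := by
  have hJ : (Fintype.card J : ℝ) ≠ 0 := by
    have : Nonempty J := ⟨j⟩
    exact_mod_cast Fintype.card_ne_zero
  have h1 : ∑ a, ∑ b, (x a - x b) ^ 2 =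
      2 * (Fintype.card J : ℝ) ^ 2 * ((𝔼 i, x i ^ 2) - (𝔼 i, x i) ^ 2) := by
    simp only [Fintype.expect_eq_sum_div_card, sub_sq, Finset.sum_add_distrib,
      Finset.sum_sub_distrib, Finset.sum_const, Finset.card_univ, nsmul_eq_mul, ← Finset.mul_sum,
      ← Finset.sum_mul]
    field_simp
    ring
  rw [← h1]
  exact (Finset.single_le_sum (f := fun b => (x j - x b) ^ 2) (fun b _ => sq_nonneg _)
    (Finset.mem_univ k)).trans (Finset.single_le_sum (f := fun a => ∑ b, (x a - x b) ^ 2)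
      (fun a _ => Finset.sum_nonneg fun b _ => sq_nonneg _) (Finset.mem_univ j))

end PathMean

/-! ### Decay of the `ℓ²` norm of a random walk (Kesten's criterion). -/

section RandomWalk

open scoped BigOperators

variable {G : Type*} [Group G] {J : Type*} [Fintype J]

open Classical in
/-- The distribution after `n` steps of the random walk with uniformly chosen increments `w j`. -/
noncomputable def walkDist (w : J → G) (n : ℕ) (g : G) : ℝ :=
  pathMean n fun l : List J => if (l.map w).prod = g then 1 else 0

theorem walkDist_nonneg (w : J → G) (n : ℕ) (g : G) : 0 ≤ walkDist w n g :=
  pathMean_nonneg fun l => by split_ifs <;> norm_num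

theorem walkDist_zero (w : J → G) (g : G) [Decidable (1 = g)] :
    walkDist w 0 g = if 1 = g then 1 else 0 := by
  simp only [walkDist, pathMean, List.map_nil, List.prod_nil]

theorem walkDist_succ (w : J → G) (n : ℕ) (g : G) :
    walkDist w (n + 1) g = 𝔼 j, walkDist w n ((w j)⁻¹ * g) := by
  classical
  refine Finset.expect_congr rfl fun j _ => congrArg (pathMean n) (funext fun l => ?_)
  refine if_congr ?_ rfl rfl
  rw [List.map_cons, List.prod_cons, eq_inv_mul_iff_mul_eq]

theorem walkDist_support_finite (w : J → G) (n : ℕ) : (walkDist w n).support.Finite := by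
  classical
  induction n with
  | zero =>
    refine (Set.finite_singleton (1 : G)).subset fun g hg => ?_
    by_contra h
    exact hg (by rw [walkDist_zero, if_neg (Ne.symm h)])
  | succ n ih =>
    refine (Set.finite_iUnion fun j : J => ih.image fun g => w j * g).subset fun g hg => ?_
    rw [Function.mem_support, walkDist_succ] at hg
    obtain ⟨j, -, hj⟩ := Finset.exists_ne_zero_of_expect_ne_zero hg
    exact Set.mem_iUnion.2 ⟨j, _, hj, by simp⟩

theorem summable_walkDist_sq (w : J → G) (n : ℕ) (g₀ : G) :
    Summable fun g => walkDist w n (g₀ * g) ^ 2 := by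
  refine (Equiv.mulLeft g₀).summable_iff (f := fun g => walkDist w n g ^ 2) |>.mpr ?_
  refine summable_of_support_finite ((walkDist_support_finite w n).subset fun _ hg => ?_)
  intro h0; simp [h0] at hg

theorem tsum_walkDist_mul_left (w : J → G) (n : ℕ) (g₀ : G) :
    ∑' g, walkDist w n (g₀ * g) ^ 2 = ∑' g, walkDist w n g ^ 2 :=
  (Equiv.mulLeft g₀).tsum_eq fun g => walkDist w n g ^ 2

theorem summable_walkDist_sq' (w : J → G) (n : ℕ) : Summable fun g => walkDist w n g ^ 2 := by
  simpa using summable_walkDist_sq w n 1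

theorem walkDist_one_pos {w : J → G} {j : J} (hj : w j = 1) (n : ℕ) : 0 < walkDist w n 1 := by
  classical
  induction n with
  | zero => simp [walkDist_zero]
  | succ n ih =>
    rw [walkDist_succ]
    refine Finset.expect_pos' (fun i _ => walkDist_nonneg w n _)
      ⟨j, Finset.mem_univ j, by simpa [hj] using ih⟩

theorem tsum_walkDist_sq_pos {w : J → G} {j : J} (hj : w j = 1) (n : ℕ) :
    0 < ∑' g, walkDist w n g ^ 2 :=
  (summable_walkDist_sq' w n).tsum_pos (fun _ => sq_nonneg _) 1 (pow_pos (walkDist_one_pos hj n) 2)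

/-- The next law is the average of the translates of the present one, so the drop of the squared
norm is the sum over `g` of their variance. A small drop thus means that all translates are close.
-/
theorem tsum_sq_sub_walkDist_le (w : J → G) (n : ℕ) (j k : J) :
    ∑' g, (walkDist w n ((w j)⁻¹ * g) - walkDist w n ((w k)⁻¹ * g)) ^ 2 ≤
      2 * (Fintype.card J : ℝ) ^ 2 *
        (∑' g, walkDist w n g ^ 2 - ∑' g, walkDist w (n + 1) g ^ 2) := by
  have hJ : Nonempty J := ⟨j⟩
  have hs : ∀ i : J, Summable fun g => walkDist w n ((w i)⁻¹ * g) ^ 2 := fun i =>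
    summable_walkDist_sq w n _
  have h1 : Summable fun g => 𝔼 i, walkDist w n ((w i)⁻¹ * g) ^ 2 := by
    simp only [Fintype.expect_eq_sum_div_card]
    exact (summable_sum fun i _ => hs i).div_const _
  have h2 : ∑' g, 𝔼 i, walkDist w n ((w i)⁻¹ * g) ^ 2 = ∑' g, walkDist w n g ^ 2 := by
    simp only [Fintype.expect_eq_sum_div_card]
    rw [tsum_div_const, Summable.tsum_finsetSum fun i _ => hs i]
    simp only [tsum_walkDist_mul_left, Finset.sum_const, Finset.card_univ, nsmul_eq_mul]
    field_simp
  have h3 := summable_walkDist_sq' w (n + 1)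
  rw [← h2, ← h1.tsum_sub h3, ← tsum_mul_left]
  have hle : ∀ g, (walkDist w n ((w j)⁻¹ * g) - walkDist w n ((w k)⁻¹ * g)) ^ 2 ≤
      2 * (Fintype.card J : ℝ) ^ 2 *
        (𝔼 i, walkDist w n ((w i)⁻¹ * g) ^ 2 - walkDist w (n + 1) g ^ 2) := fun g => by
    rw [walkDist_succ]
    exact sq_sub_le_expect (fun i => walkDist w n ((w i)⁻¹ * g)) j k
  have hr := (h1.sub h3).mul_left (2 * (Fintype.card J : ℝ) ^ 2)
  exact (Summable.of_nonneg_of_le (fun _ => sq_nonneg _) hle hr).tsum_le_tsum hle hr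

/-- If the `ℓ²`-norms of the distributions of a random walk do not decay exponentially, then the
group is amenable. -/
theorem isAmenable_or_exponential_decay {S : Set G} (hS : IsSymmGenSet S) (w : J → G)
    (h1 : ∃ j, w j = 1) (hw : ∀ s ∈ S, ∃ j, w j = s) :
    IsAmenable G ∨ ∃ ρ : ℝ, 0 ≤ ρ ∧ ρ < 1 ∧ ∀ n, ∑' g, walkDist w n g ^ 2 ≤ ρ ^ n := by
  classical
  obtain ⟨k, hk⟩ := h1
  have hJ : Nonempty J := ⟨k⟩
  have hc : (0 : ℝ) < Fintype.card J := by exact_mod_cast Fintype.card_pos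
  -- Either every step contracts the squared norm by a uniform factor, or some step hardly does, and
  -- the law at that time is almost invariant.
  by_cases hρ : ∃ ρ : ℝ, 0 ≤ ρ ∧ ρ < 1 ∧
      ∀ n, ∑' g, walkDist w (n + 1) g ^ 2 ≤ ρ * ∑' g, walkDist w n g ^ 2
  · right
    obtain ⟨ρ, hρ0, hρ1, h⟩ := hρ
    refine ⟨ρ, hρ0, hρ1, fun n => ?_⟩
    induction n with
    | zero => simp [walkDist_zero]
    | succ n ih => rw [pow_succ']; exact (h n).trans (by gcongr)
  · left
    refine isAmenable_of_almost_invariant_vectors hS fun ε hε => ?_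
    set c := ε / (2 * (Fintype.card J : ℝ) ^ 2) with hcdef
    have hc0 : 0 < c := by positivity
    have : ∃ n, (1 - c) * ∑' g, walkDist w n g ^ 2 ≤ ∑' g, walkDist w (n + 1) g ^ 2 := by
      by_contra! hcon
      refine hρ ⟨max (1 - c) 0, le_max_right _ _, by simp [hc0], fun n => (hcon n).le.trans ?_⟩
      exact mul_le_mul_of_nonneg_right (le_max_left _ _) (tsum_walkDist_sq_pos hk n).le
    obtain ⟨n, hn⟩ := this
    refine ⟨walkDist w n, walkDist_support_finite w n, tsum_walkDist_sq_pos hk n, fun s hs => ?_⟩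
    -- Translates in `walkDist_succ` are by inverses, so the letter `s⁻¹` gives the shift by `s`;
    -- the letter `k`, mapped to `1`, gives the law itself.
    obtain ⟨j, hj⟩ := hw s⁻¹ (hS.symm s hs)
    have := tsum_sq_sub_walkDist_le w n j k
    simp only [hj, hk, inv_inv, inv_one, one_mul] at this
    refine this.trans ?_
    have e : ε = 2 * (Fintype.card J : ℝ) ^ 2 * c := by rw [hcdef]; field_simp
    rw [e, mul_assoc _ c]
    gcongr
    linarith

end RandomWalk

/-! ### Moments of cocycles along the random walk. -/

section Martingale

open scoped BigOperators

/-- Power-type smoothness of exponent `q` with constant `K`. -/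
def IsPowerSmooth (X : Type*) [NormedAddCommGroup X] (q K : ℝ) : Prop :=
  ∀ x y : X, ‖x + y‖ ^ q + ‖x - y‖ ^ q ≤ 2 * ‖x‖ ^ q + K * ‖y‖ ^ q

/-- Jensen's inequality: `x` is the mean of the vectors `x - d i`. -/
theorem norm_rpow_le_expect (𝕜 : Type*) [RCLike 𝕜] {X : Type*} [NormedAddCommGroup X]
    [NormedSpace 𝕜 X] {q : ℝ} (hq : 1 ≤ q) {ι : Type*} [Fintype ι] [Nonempty ι]
    {d : ι → X} (hd : ∑ i, d i = 0) (x : X) : ‖x‖ ^ q ≤ 𝔼 i, ‖x - d i‖ ^ q := by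
  have hc : (0 : ℝ) < Fintype.card ι := by exact_mod_cast Fintype.card_pos
  have h1 : (Fintype.card ι : ℝ) * ‖x‖ ≤ ∑ i, ‖x - d i‖ := by
    have h : ∑ i, (x - d i) = (Fintype.card ι : 𝕜) • x := by
      simp [Finset.sum_sub_distrib, hd, Nat.cast_smul_eq_nsmul]
    calc (Fintype.card ι : ℝ) * ‖x‖ = ‖(Fintype.card ι : 𝕜) • x‖ := by
          rw [norm_smul, RCLike.norm_natCast]
      _ ≤ _ := by rw [← h]; exact norm_sum_le _ _
  have h2 : ‖x‖ ≤ ∑ i, (Fintype.card ι : ℝ)⁻¹ * ‖x - d i‖ := by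
    rw [← Finset.mul_sum, ← div_eq_inv_mul, le_div_iff₀ hc]
    linarith
  calc ‖x‖ ^ q ≤ (∑ i, (Fintype.card ι : ℝ)⁻¹ * ‖x - d i‖) ^ q := by gcongr
    _ ≤ ∑ i, (Fintype.card ι : ℝ)⁻¹ * ‖x - d i‖ ^ q :=
        Real.rpow_arith_mean_le_arith_mean_rpow _ _ _ (fun i _ => by positivity)
          (by simp [hc.ne']) (fun i _ => norm_nonneg _) hq
    _ = _ := by rw [Fintype.expect_eq_sum_div_card, ← Finset.mul_sum, div_eq_inv_mul]

/-- After averaging the smoothness inequality over `i`, Jensen's bound for the minus terms absorbs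
one of the two copies of `‖x‖ ^ q`. -/
theorem IsPowerSmooth.expect_le (𝕜 : Type*) [RCLike 𝕜] {X : Type*} [NormedAddCommGroup X]
    [NormedSpace 𝕜 X] {q K : ℝ} (hq : 1 ≤ q) (hX : IsPowerSmooth X q K)
    {ι : Type*} [Fintype ι] [Nonempty ι] {d : ι → X} (hd : ∑ i, d i = 0) (x : X) :
    𝔼 i, ‖x + d i‖ ^ q ≤ ‖x‖ ^ q + K * 𝔼 i, ‖d i‖ ^ q := by
  have h1 := norm_rpow_le_expect 𝕜 hq hd x
  have h2 : 𝔼 i, (‖x + d i‖ ^ q + ‖x - d i‖ ^ q) ≤ 𝔼 i, (2 * ‖x‖ ^ q + K * ‖d i‖ ^ q) :=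
    Finset.expect_le_expect fun i _ => hX x (d i)
  rw [Finset.expect_add_distrib, Finset.expect_add_distrib, Fintype.expect_const,
    ← Finset.mul_expect] at h2
  linarith

variable {𝕜 : Type*} [RCLike 𝕜] {G : Type*} [Group G]
  {X : Type*} [NormedAddCommGroup X] [NormedSpace 𝕜 X]

variable {T : Finset G}

theorem map_mul_apply (π : G →* (X ≃ₗᵢ[𝕜] X)) (x y : G) (v : X) :
    π (x * y) v = π x (π y v) := by
  rw [map_mul]; rfl

/-- The increment of the walk whose steps are products of two independent elements of `T`. -/
def pairStep (T : Finset G) (j : T × T) : G := j.1 * j.2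

variable (π : G →* (X ≃ₗᵢ[𝕜] X)) (d : G → X)

/-- The martingale with increments `π(s₁) d(s₂)`. -/
def forwardSum : List (T × T) → X
  | [] => 0
  | j :: l => π j.1 (d j.2) + π (pairStep T j) (forwardSum l)

/-- The reversed martingale with increments `π(s₁) d(s₁⁻¹)`. -/
def backwardSum : List (T × T) → X
  | [] => 0
  | j :: l => π j.1 (d (j.1 : G)⁻¹ + π j.2 (backwardSum l))

variable {π d}

/-- Given `s₁`, the increment `π(s₁) d(s₂)` is centred. Undoing the first step by an isometry turns
the remaining sum into the same walk from a new vector, which is why the induction is over all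
starting points `x`. -/
theorem pathMean_forwardSum_le [Nonempty T] {q K : ℝ} (hq : 1 ≤ q) (hX : IsPowerSmooth X q K)
    (hd : ∑ t : T, d t = 0) (n : ℕ) (x : X) :
    pathMean n (fun l : List (T × T) => ‖x + forwardSum π d l‖ ^ q) ≤
      ‖x‖ ^ q + n * (K * 𝔼 t : T, ‖d t‖ ^ q) := by
  set C := K * 𝔼 t : T, ‖d t‖ ^ q with hC
  induction n generalizing x with
  | zero => simp [pathMean, forwardSum]
  | succ n ih =>
    have h1 : ∀ (j : T × T) (l : List (T × T)), ‖x + forwardSum π d (j :: l)‖ =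
        ‖π (pairStep T j)⁻¹ (x + π j.1 (d j.2)) + forwardSum π d l‖ := by
      intro j l
      rw [← (π (pairStep T j)).norm_map (_ + forwardSum π d l), map_add,
        ← map_mul_apply, mul_inv_cancel, map_one, LinearIsometryEquiv.coe_one, id, add_assoc]
      rfl
    have h2 : ∀ s : T, 𝔼 t : T, ‖x + π s (d t)‖ ^ q ≤ ‖x‖ ^ q + C := by
      intro s
      have hd' : ∑ t : T, π s (d t) = 0 := by rw [← map_sum, hd, map_zero]
      simpa [hC] using hX.expect_le 𝕜 hq hd' x
    calc 𝔼 j : T × T, pathMean n (fun l => ‖x + forwardSum π d (j :: l)‖ ^ q)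
        ≤ 𝔼 j : T × T, (‖x + π j.1 (d j.2)‖ ^ q + n * C) := by
          refine Finset.expect_le_expect fun j _ => ?_
          simp only [h1]
          refine (ih _).trans_eq ?_
          rw [LinearIsometryEquiv.norm_map]
      _ = (𝔼 s : T, 𝔼 t : T, ‖x + π s (d t)‖ ^ q) + n * C := by
          rw [Finset.expect_add_distrib, Fintype.expect_const, ← Finset.univ_product_univ,
            Finset.expect_product]
      _ ≤ (𝔼 _s : T, (‖x‖ ^ q + C)) + n * C := by
          gcongr with s
          exact h2 s
      _ = _ := by rw [Fintype.expect_const]; push_cast; ring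

/-- Here the first pair is the last martingale step: the outer `π(s₁)` does not change the norm, and
`d(s₁⁻¹)` is centred and independent of `s₂` and the tail. -/
theorem pathMean_backwardSum_le [Nonempty T] {q K : ℝ} (hq : 1 ≤ q) (hX : IsPowerSmooth X q K)
    (hd : ∑ t : T, d (t : G)⁻¹ = 0) (n : ℕ) :
    pathMean n (fun l : List (T × T) => ‖backwardSum π d l‖ ^ q) ≤
      n * (K * 𝔼 t : T, ‖d (t : G)⁻¹‖ ^ q) := by
  set C := K * 𝔼 t : T, ‖d (t : G)⁻¹‖ ^ q with hC
  induction n with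
  | zero => simp [pathMean, backwardSum, show q ≠ 0 by linarith]
  | succ n ih =>
    have h1 : ∀ (j : T × T) (l : List (T × T)), ‖backwardSum π d (j :: l)‖ =
        ‖π j.2 (backwardSum π d l) + d (j.1 : G)⁻¹‖ := by
      intro j l
      rw [backwardSum, LinearIsometryEquiv.norm_map, add_comm]
    calc 𝔼 j : T × T, pathMean n (fun l => ‖backwardSum π d (j :: l)‖ ^ q)
        = 𝔼 t : T, pathMean n fun l =>
            𝔼 s : T, ‖π t (backwardSum π d l) + d (s : G)⁻¹‖ ^ q := by
          simp only [h1, pathMean_expect]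
          rw [← Finset.univ_product_univ, Finset.expect_product, Finset.expect_comm]
      _ ≤ 𝔼 t : T, pathMean n fun l => (‖backwardSum π d l‖ ^ q + C) := by
          refine Finset.expect_le_expect fun t _ => pathMean_mono fun l => ?_
          simpa [hC] using hX.expect_le 𝕜 hq hd (π t (backwardSum π d l))
      _ = pathMean n (fun l => ‖backwardSum π d l‖ ^ q) + C := by
          rw [Fintype.expect_const, pathMean_add, pathMean_const]
      _ ≤ _ := by push_cast; linarith

theorem IsOneCocycle.map_one {b : G → X} (hb : IsOneCocycle 𝕜 π b) : b 1 = 0 := by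
  have := hb 1 1
  simpa using this

theorem IsOneCocycle.map_inv {b : G → X} (hb : IsOneCocycle 𝕜 π b) (x : G) :
    π x (b x⁻¹) = - b x := by
  have := hb x x⁻¹
  rw [mul_inv_cancel, hb.map_one] at this
  exact eq_neg_of_add_eq_zero_left this.symm

/-- This is why steps come in pairs: since `b(s₁) = -π(s₁) b(s₁⁻¹)`, the two letters of a pair
contribute `π(s₁) b(s₂)` and `-π(s₁) b(s₁⁻¹)`, and the drift `π(s₁) m` cancels. -/
theorem IsOneCocycle.apply_prod_eq {b : G → X} (hb : IsOneCocycle 𝕜 π b) (m : X)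
    (l : List (T × T)) : b (l.map (pairStep T)).prod =
      forwardSum π (fun g => b g - m) l - backwardSum π (fun g => b g - m) l := by
  induction l with
  | nil => simp [forwardSum, backwardSum, hb.map_one]
  | cons j l ih =>
    have h1 : b j.1 = -π j.1 (b (j.1 : G)⁻¹) := by rw [hb.map_inv, neg_neg]
    rw [List.map_cons, List.prod_cons, hb, ih, forwardSum, backwardSum, pairStep, hb, h1]
    simp only [map_mul_apply, map_sub, map_add]
    abel

theorem norm_sub_rpow_le {q : ℝ} (hq : 0 ≤ q) (x y : X) :
    ‖x - y‖ ^ q ≤ 2 ^ q * (‖x‖ ^ q + ‖y‖ ^ q) := by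
  have h1 : ‖x - y‖ ≤ 2 * max ‖x‖ ‖y‖ := by
    linarith [norm_sub_le x y, le_max_left ‖x‖ ‖y‖, le_max_right ‖x‖ ‖y‖]
  calc ‖x - y‖ ^ q ≤ (2 * max ‖x‖ ‖y‖) ^ q := by gcongr
    _ = 2 ^ q * max ‖x‖ ‖y‖ ^ q := Real.mul_rpow (by norm_num) (by positivity)
    _ ≤ _ := by
      gcongr
      rcases max_cases ‖x‖ ‖y‖ with h | h <;> rw [h.1]
      · linarith [Real.rpow_nonneg (norm_nonneg y) q]
      · linarith [Real.rpow_nonneg (norm_nonneg x) q]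

/-- The moments of a cocycle along the random walk grow at most linearly. -/
theorem IsOneCocycle.exists_pathMean_le {b : G → X} (hb : IsOneCocycle 𝕜 π b) {q K : ℝ}
    (hq : 1 ≤ q) (hX : IsPowerSmooth X q K) [Nonempty T] (hT : ∀ t ∈ T, t⁻¹ ∈ T) :
    ∃ C : ℝ, ∀ n : ℕ,
      pathMean n (fun l : List (T × T) => ‖b (l.map (pairStep T)).prod‖ ^ q) ≤ C * n := by
  have hc : (Fintype.card T : 𝕜) ≠ 0 := by exact_mod_cast Fintype.card_ne_zero
  set m : X := (Fintype.card T : 𝕜)⁻¹ • ∑ t : T, b t with hm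
  set d : G → X := fun g => b g - m with hd
  have h1 : ∑ t : T, d t = 0 := by
    simp only [hd, Finset.sum_sub_distrib, Finset.sum_const, Finset.card_univ]
    rw [← Nat.cast_smul_eq_nsmul 𝕜, hm, smul_smul, mul_inv_cancel₀ hc, one_smul, sub_self]
  have h2 : ∑ t : T, d (t : G)⁻¹ = 0 := by
    rw [← h1]
    -- Inversion permutes `T`, so the same mean `m` also centres the reversed increments.
    let e : T ≃ T := ⟨fun t => ⟨(t : G)⁻¹, hT t t.2⟩, fun t => ⟨(t : G)⁻¹, hT t t.2⟩,
      fun t => by simp, fun t => by simp⟩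
    exact Equiv.sum_comp e fun t : T => d t
  refine ⟨2 ^ q * (K * 𝔼 t : T, ‖d t‖ ^ q + K * 𝔼 t : T, ‖d (t : G)⁻¹‖ ^ q), fun n => ?_⟩
  have hF := pathMean_forwardSum_le (π := π) hq hX h1 n 0
  have hR := pathMean_backwardSum_le (π := π) hq hX h2 n
  simp only [zero_add, norm_zero, Real.zero_rpow (show q ≠ 0 by linarith)] at hF
  calc _ ≤ pathMean n fun l : List (T × T) =>
        2 ^ q * (‖forwardSum π d l‖ ^ q + ‖backwardSum π d l‖ ^ q) := by
        refine pathMean_mono fun l => ?_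
        rw [hb.apply_prod_eq m l]
        exact norm_sub_rpow_le (by linarith) _ _
    _ ≤ 2 ^ q * (n * (K * 𝔼 t : T, ‖d t‖ ^ q) + n * (K * 𝔼 t : T, ‖d (t : G)⁻¹‖ ^ q)) := by
        rw [pathMean_mul_left, pathMean_add]
        gcongr
    _ = _ := by ring

end Martingale

/-! ### Word length and balls. -/

section WordLength

variable {G : Type*} [Group G]

theorem IsSymmGenSet.exists_list {S : Set G} (hS : IsSymmGenSet S) (g : G) :
    ∃ l : List G, (∀ s ∈ l, s ∈ S) ∧ l.prod = g ∧ l.length = wordLength S g := by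
  refine Nat.sInf_mem (s := {n : ℕ | ∃ l : List G, (∀ s ∈ l, s ∈ S) ∧ l.prod = g ∧ l.length = n}) ?_
  have hg : g ∈ (Subgroup.closure S).toSubmonoid := by simp [hS.closure_eq_top]
  rw [Subgroup.closure_toSubmonoid] at hg
  obtain ⟨l, hl, hprod⟩ := Submonoid.exists_list_of_mem_closure hg
  refine ⟨l.length, l, fun s hs => ?_, hprod, rfl⟩
  rcases hl s hs with h | h
  · exact h
  · simpa using hS.symm _ h

theorem wordLength_le {S : Set G} {l : List G} (hl : ∀ s ∈ l, s ∈ S) :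
    wordLength S l.prod ≤ l.length :=
  Nat.sInf_le ⟨l, hl, rfl, rfl⟩

open scoped Pointwise in
theorem mem_pow_of_wordLength_le [DecidableEq G] {S : Set G} (hS : IsSymmGenSet S) {T : Finset G}
    (hST : ∀ s ∈ S, s ∈ T) (h1 : 1 ∈ T) {g : G} {r : ℕ} (hg : wordLength S g ≤ r) : g ∈ T ^ r := by
  obtain ⟨l, hl, rfl, hlen⟩ := hS.exists_list g
  refine Finset.pow_subset_pow_right h1 (hlen.trans_le hg) ?_
  clear hlen hg
  induction l with
  | nil => simp
  | cons a l ih =>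
    rw [List.prod_cons, List.length_cons, pow_succ']
    exact Finset.mul_mem_mul (hST a (hl a (by simp))) (ih fun s hs => hl s (by simp [hs]))

end WordLength

/-! ### Compression above `1/q` forces amenability. -/

section UpperBound

variable {𝕜 : Type*} [RCLike 𝕜] {G : Type*} [Group G]
  {X : Type*} [NormedAddCommGroup X] [NormedSpace 𝕜 X]

/-- An orbit map minus its value at `1` is itself a cocycle for the same linear part. -/
theorem HasEquivariantCompression.exists_cocycle {S : Set G} {α : ℝ≥0}
    (h : HasEquivariantCompression 𝕜 X S α) :
    ∃ (π : G →* (X ≃ₗᵢ[𝕜] X)) (b : G → X) (c : ℝ), IsOneCocycle 𝕜 π b ∧ 0 < c ∧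
      ∀ x, x ≠ 1 → c * (wordLength S x : ℝ) ^ (α : ℝ) ≤ ‖b x‖ := by
  obtain ⟨ψ, ⟨π, f, v, hf, hψ⟩, -, c, hc, hlow⟩ := h
  refine ⟨π, fun x => ψ x - ψ 1, c, fun x y => ?_, hc, fun x hx => ?_⟩
  · simp only [hψ, hf x y, hf.map_one, map_mul_apply, map_sub, map_add, map_one,
      LinearIsometryEquiv.coe_one, id, add_zero]
    abel
  · have := hlow 1 x hx.symm
    rwa [wordDist, inv_one, one_mul, norm_sub_rev] at this

-- Outside `T ^ r`, which contains the ball of radius `r`, `‖b‖ ^ q` is at least twice `M`, so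
-- Markov's inequality puts the walk in `T ^ r` with probability at least `1/2`. Cauchy–Schwarz over
-- at most `|T| ^ r` points finishes.
open scoped Pointwise in
theorem quarter_le_card_pow_mul_tsum [DecidableEq G] {S : Set G} (hS : IsSymmGenSet S) {T : Finset G}
    (hST : ∀ s ∈ S, s ∈ T) (h1 : 1 ∈ T) {b : G → X} {q α c M : ℝ} (hq : 0 < q) (hα : 0 ≤ α)
    (hc : 0 < c) (hb : ∀ x, x ≠ 1 → c * (wordLength S x : ℝ) ^ α ≤ ‖b x‖) {n r : ℕ} (hr : 0 < r)
    (hn : pathMean n (fun l : List (T × T) => ‖b (l.map (pairStep T)).prod‖ ^ q) ≤ M)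
    (hM : M ≤ (c * (r : ℝ) ^ α) ^ q / 2) :
    1 / 4 ≤ (T.card : ℝ) ^ r * ∑' g, walkDist (pairStep T) n g ^ 2 := by
  classical
  have : Nonempty T := ⟨1, h1⟩
  set lam := (c * (r : ℝ) ^ α) ^ q with hlam
  have hlam0 : 0 < lam := by positivity
  have hsum : ∑ g ∈ T ^ r, walkDist (pairStep T) n g =
      pathMean n fun l : List (T × T) => if (l.map (pairStep T)).prod ∈ T ^ r then 1 else 0 := by
    simp only [walkDist]
    rw [← pathMean_sum]
    congr 1
    funext l
    convert Finset.sum_ite_eq (T ^ r) (l.map (pairStep T)).prod fun _ => (1 : ℝ)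
  have hpt : ∀ l : List (T × T), (1 : ℝ) ≤ (if (l.map (pairStep T)).prod ∈ T ^ r then 1 else 0) +
      lam⁻¹ * ‖b (l.map (pairStep T)).prod‖ ^ q := by
    intro l
    set g := (l.map (pairStep T)).prod with hg
    split_ifs with hgB
    · have : 0 ≤ lam⁻¹ * ‖b g‖ ^ q := by positivity
      linarith
    · have hlen : r < wordLength S g := by
        by_contra hle
        exact hgB (mem_pow_of_wordLength_le hS hST h1 (not_lt.mp hle))
      have hg1 : g ≠ 1 := by
        rintro h
        exact hgB (h ▸ Finset.one_mem_pow h1)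
      have : lam ≤ ‖b g‖ ^ q := by
        refine Real.rpow_le_rpow (by positivity) (le_trans ?_ (hb g hg1)) hq.le
        gcongr
      rw [zero_add, ← div_eq_inv_mul, le_div_iff₀ hlam0, one_mul]
      exact this
  have hhalf : 1 / 2 ≤ ∑ g ∈ T ^ r, walkDist (pairStep T) n g := by
    have h2 := pathMean_mono (n := n) hpt
    rw [pathMean_const, pathMean_add, ← hsum, pathMean_mul_left] at h2
    have h3 : lam⁻¹ * pathMean n (fun l : List (T × T) =>
        ‖b (l.map (pairStep T)).prod‖ ^ q) ≤ 1 / 2 := by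
      rw [← div_eq_inv_mul, div_le_iff₀ hlam0]
      linarith
    linarith
  have hcs := sq_sum_le_card_mul_sum_sq (s := T ^ r) (f := walkDist (pairStep T) n)
  have hts : ∑ g ∈ T ^ r, walkDist (pairStep T) n g ^ 2 ≤ ∑' g, walkDist (pairStep T) n g ^ 2 :=
    (summable_walkDist_sq' _ n).sum_le_tsum _ fun g _ => sq_nonneg _
  have hcard : ((T ^ r).card : ℝ) ≤ (T.card : ℝ) ^ r := by exact_mod_cast Finset.card_pow_le
  calc (1 / 4 : ℝ) ≤ (∑ g ∈ T ^ r, walkDist (pairStep T) n g) ^ 2 := by nlinarith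
    _ ≤ _ := hcs
    _ ≤ _ := by gcongr

/-- A group with equivariant compression exponent larger than `1 / q` in a space which is smooth
of power type `q` is amenable. -/
theorem isAmenable_of_hasEquivariantCompression {S : Set G} (hS : IsSymmGenSet S) {q K : ℝ}
    (hq : 1 ≤ q) (hX : IsPowerSmooth X q K) {α : ℝ≥0} (hα : 1 < α * q)
    (h : HasEquivariantCompression 𝕜 X S α) : IsAmenable G := by
  classical
  obtain ⟨π, b, c, hb, hc, hlow⟩ := h.exists_cocycle
  set T : Finset G := insert 1 hS.finite.toFinset with hT
  have h1 : (1 : G) ∈ T := by simp [hT]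
  have hST : ∀ s ∈ S, s ∈ T := fun s hs => by simp [hT, hs]
  have hTsymm : ∀ t ∈ T, t⁻¹ ∈ T := by
    intro t ht
    rcases Finset.mem_insert.mp ht with rfl | ht
    · simpa using h1
    · exact hST _ (hS.symm t (by simpa using ht))
  have : Nonempty T := ⟨1, h1⟩
  rcases isAmenable_or_exponential_decay hS (pairStep T)
    ⟨(⟨1, h1⟩, ⟨1, h1⟩), by simp [pairStep]⟩
    (fun s hs => ⟨(⟨s, hST s hs⟩, ⟨1, h1⟩), by simp [pairStep]⟩) with hG | ⟨ρ, hρ0, hρ1, hρ⟩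
  · exact hG
  exfalso
  obtain ⟨C, hC⟩ := hb.exists_pathMean_le hq hX hTsymm
  have hT0 : (0 : ℝ) < T.card := by exact_mod_cast Finset.card_pos.mpr ⟨1, h1⟩
  -- This `k` makes the decay at time `k r` beat the growth `|T| ^ r` of the ball.
  obtain ⟨k, hk⟩ := exists_pow_lt_of_lt_one (show (0 : ℝ) < 1 / (2 * T.card) by positivity) hρ1
  have hk' : T.card * ρ ^ k ≤ 1 / 2 := by
    rw [lt_div_iff₀ (by positivity)] at hk
    linarith
  have hγ : 0 < α * q - 1 := by linarith
  have htend := (tendsto_rpow_atTop hγ).comp tendsto_natCast_atTop_atTop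
  -- As `α q > 1`, a large `r` satisfies `C k r ≤ (c r^α)^q / 2`. With `r ≥ 3` the final bound
  -- `(1/2)^r ≤ 1/8` contradicts `1/4`.
  obtain ⟨r, hr, hr3⟩ := ((htend.eventually_ge_atTop (2 * C * k / c ^ q)).and
    (Filter.eventually_ge_atTop 3)).exists
  have hr0 : (0 : ℝ) < r := by exact_mod_cast (by omega : 0 < r)
  have hM : C * ((k * r : ℕ) : ℝ) ≤ (c * (r : ℝ) ^ (α : ℝ)) ^ q / 2 := by
    rw [Real.mul_rpow hc.le (by positivity), ← Real.rpow_mul hr0.le]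
    simp only [Function.comp_apply] at hr
    rw [div_le_iff₀ (by positivity), Real.rpow_sub hr0, Real.rpow_one, div_mul_eq_mul_div,
      le_div_iff₀ hr0] at hr
    push_cast
    linarith
  have key := quarter_le_card_pow_mul_tsum hS hST h1 (by linarith) α.2 hc hlow (by omega)
    (hC (k * r)) hM
  have : (T.card : ℝ) ^ r * ∑' g, walkDist (pairStep T) (k * r) g ^ 2 ≤ 1 / 8 := by
    calc _ ≤ (T.card : ℝ) ^ r * ρ ^ (k * r) := by gcongr; exact hρ _
      _ = (T.card * ρ ^ k) ^ r := by rw [mul_pow, pow_mul]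
      _ ≤ (1 / 2) ^ r := by gcongr
      _ ≤ (1 / 2) ^ 3 := pow_le_pow_of_le_one (by norm_num) (by norm_num) hr3
      _ = 1 / 8 := by norm_num
  linarith

end UpperBound

/-! ### Two-point inequalities for scalars. -/

section Pointwise

theorem rpow_midpoint_le {x y s : ℝ} (hx : 0 ≤ x) (hy : 0 ≤ y) (hs : 1 ≤ s) :
    (1 / 2 * x + 1 / 2 * y) ^ s ≤ 1 / 2 * x ^ s + 1 / 2 * y ^ s :=
  (convexOn_rpow hs).2 hx hy (by norm_num) (by norm_num) (by norm_num)

variable {𝕜 : Type*} [RCLike 𝕜]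

/-- Raise to the power `2/P ≥ 1`: convexity on the left and superadditivity on the right reduce it
to the parallelogram law. -/
theorem norm_add_rpow_add_norm_sub_rpow_le {P : ℝ} (hP0 : 0 < P) (hP2 : P ≤ 2) (a b : 𝕜) :
    ‖a + b‖ ^ P + ‖a - b‖ ^ P ≤ 2 * ‖a‖ ^ P + 2 * ‖b‖ ^ P := by
  have hs : 1 ≤ 2 / P := by rw [le_div_iff₀ hP0]; linarith
  have hpow : ∀ x : ℝ, 0 ≤ x → (x ^ P) ^ (2 / P) = x ^ 2 := by
    intro x hx
    rw [← Real.rpow_mul hx, mul_div_cancel₀ _ hP0.ne', Real.rpow_two]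
  have h1 := rpow_midpoint_le (x := ‖a + b‖ ^ P) (y := ‖a - b‖ ^ P)
    (by positivity) (by positivity) hs
  have h2 := Real.add_rpow_le_rpow_add (a := ‖a‖ ^ P) (b := ‖b‖ ^ P)
    (by positivity) (by positivity) hs
  rw [hpow _ (norm_nonneg _), hpow _ (norm_nonneg _)] at h1 h2
  have h3 := parallelogram_law_with_norm 𝕜 a b
  have h4 : (1 / 2 * ‖a + b‖ ^ P + 1 / 2 * ‖a - b‖ ^ P) ^ (2 / P) ≤
      (‖a‖ ^ P + ‖b‖ ^ P) ^ (2 / P) := by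
    refine h1.trans (le_trans ?_ h2)
    nlinarith
  have h5 := (Real.rpow_le_rpow_iff (by positivity) (by positivity) (by positivity)).mp h4
  linarith

/-- Use `1 + t ≤ exp t` on each summand, then `cosh u ≤ exp (u² / 2)`. -/
theorem rpow_add_rpow_le_exp {A r s : ℝ} (hs : 0 ≤ s) (hA : 0 < A) (hr : |r| ≤ A) :
    (A + r) ^ s + (A - r) ^ s ≤ 2 * A ^ s * Real.exp ((s * (r / A)) ^ 2 / 2) := by
  have key : ∀ t : ℝ, |t| ≤ A → (A + t) ^ s ≤ A ^ s * Real.exp (s * (t / A)) := by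
    intro t ht
    have h1 : 0 ≤ 1 + t / A := by
      have : -1 ≤ t / A := by rw [le_div_iff₀ hA]; linarith [neg_abs_le t]
      linarith
    have h2 : A + t = A * (1 + t / A) := by field_simp
    rw [h2, Real.mul_rpow hA.le h1, mul_comm s, Real.exp_mul]
    gcongr
    linarith [Real.add_one_le_exp (t / A)]
  have h1 := key r hr
  have h2 := key (-r) (by rwa [abs_neg])
  have h3 := Real.cosh_le_exp_half_sq (s * (r / A))
  rw [Real.cosh_eq] at h3
  have h4 : s * (-r / A) = -(s * (r / A)) := by ring
  rw [h4, ← sub_eq_add_neg] at h2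
  have h5 : 0 ≤ A ^ s := by positivity
  nlinarith

/-- With `A = |a|² + |b|²` one has `|a ± b|² = A ± r` and `(r/A)² ≤ 4x` for `x = |b|²/A`. The
exponential bound gives `2 (A exp(Px))^(P/2)`, and convexity of `exp` makes `exp(Px)` affine in `x ∈
[0, 1]`. -/
theorem norm_add_rpow_add_norm_sub_rpow_le_of_two_le {P : ℝ} (hP2 : 2 ≤ P) (a b : 𝕜) :
    ‖a + b‖ ^ P + ‖a - b‖ ^ P ≤ 2 * (‖a‖ ^ 2 + Real.exp P * ‖b‖ ^ 2) ^ (P / 2) := by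
  set A := ‖a‖ ^ 2 + ‖b‖ ^ 2 with hA
  rcases (show 0 ≤ A by positivity).eq_or_lt with h0 | hA0
  · have ha : ‖a‖ ^ 2 = 0 := by nlinarith [sq_nonneg ‖a‖, sq_nonneg ‖b‖]
    have hb : ‖b‖ ^ 2 = 0 := by nlinarith [sq_nonneg ‖a‖, sq_nonneg ‖b‖]
    have ha' : a = 0 := by simpa using ha
    have hb' : b = 0 := by simpa using hb
    subst ha' hb'
    simp [Real.zero_rpow (show P ≠ 0 by linarith), Real.zero_rpow (show P / 2 ≠ 0 by linarith)]
  set r := ‖a + b‖ ^ 2 - A with hr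
  have hpar := parallelogram_law_with_norm 𝕜 a b
  have e1 : ‖a + b‖ ^ 2 = A + r := by rw [hr]; ring
  have e2 : ‖a - b‖ ^ 2 = A - r := by rw [hr, hA]; nlinarith
  have hr1 : |r| ≤ 2 * ‖a‖ * ‖b‖ := by
    rw [abs_le]
    constructor
    · nlinarith [norm_sub_le a b, norm_nonneg (a - b), norm_nonneg a, norm_nonneg b]
    · nlinarith [norm_add_le a b, norm_nonneg (a + b), norm_nonneg a, norm_nonneg b]
  have hrA : |r| ≤ A := hr1.trans (by nlinarith [sq_nonneg (‖a‖ - ‖b‖)])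
  have hpow : ∀ x : ℝ, 0 ≤ x → x ^ P = (x ^ 2) ^ (P / 2) := by
    intro x hx
    rw [← Real.rpow_two, ← Real.rpow_mul hx]
    congr 1; ring
  set x := ‖b‖ ^ 2 / A with hx
  have hx0 : 0 ≤ x := by positivity
  have hx1 : x ≤ 1 := by rw [hx, div_le_one hA0]; nlinarith [sq_nonneg ‖a‖]
  have hrx : (r / A) ^ 2 ≤ 4 * x := by
    rw [hx, div_pow, div_le_iff₀ (by positivity)]
    have : r ^ 2 ≤ (2 * ‖a‖ * ‖b‖) ^ 2 := sq_le_sq' (by linarith [neg_abs_le r]) (by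
      linarith [le_abs_self r])
    have e : 4 * (‖b‖ ^ 2 / A) * A ^ 2 = 4 * ‖b‖ ^ 2 * A := by field_simp
    rw [e]
    nlinarith [sq_nonneg ‖a‖, sq_nonneg ‖b‖, mul_nonneg (sq_nonneg ‖b‖) (sq_nonneg ‖b‖)]
  have hexp : Real.exp (P * x) ≤ 1 + (Real.exp P - 1) * x := by
    have := convexOn_exp.2 (Set.mem_univ P) (Set.mem_univ 0) hx0 (by linarith : 0 ≤ 1 - x)
      (by ring)
    simp only [smul_eq_mul, mul_zero, add_zero, Real.exp_zero, mul_one] at this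
    rw [mul_comm P x]
    linarith
  rw [hpow _ (norm_nonneg _), hpow _ (norm_nonneg _), e1, e2]
  refine (rpow_add_rpow_le_exp (by linarith) hA0 hrA).trans ?_
  calc 2 * A ^ (P / 2) * Real.exp ((P / 2 * (r / A)) ^ 2 / 2)
      ≤ 2 * A ^ (P / 2) * Real.exp (P * x * (P / 2)) := by
        gcongr
        nlinarith [sq_nonneg P]
    _ = 2 * (A * Real.exp (P * x)) ^ (P / 2) := by
        rw [Real.mul_rpow hA0.le (Real.exp_pos _).le, Real.exp_mul (P * x)]
        ring
    _ ≤ 2 * (A * (1 + (Real.exp P - 1) * x)) ^ (P / 2) := by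
        gcongr
    _ = _ := by
        have : A * (1 + (Real.exp P - 1) * x) = ‖a‖ ^ 2 + Real.exp P * ‖b‖ ^ 2 := by
          rw [hx]; field_simp; rw [hA]; ring
        rw [this]

end Pointwise

/-! ### Power smoothness of `L_p`. -/

section Lp

variable {𝕜 : Type*} [RCLike 𝕜] {Ω : Type*} [MeasurableSpace Ω] {μ : Measure Ω}

theorem Lp_norm_rpow_eq_integral {E : Type*} [NormedAddCommGroup E] {p : ℝ≥0∞} (hp0 : p ≠ 0)
    (hp : p ≠ ∞) (f : Lp E p μ) : ‖f‖ ^ p.toReal = ∫ x, ‖f x‖ ^ p.toReal ∂μ := by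
  have h0 : 0 < p.toReal := ENNReal.toReal_pos hp0 hp
  have hI : 0 ≤ ∫ x, ‖f x‖ ^ p.toReal ∂μ := integral_nonneg fun x => by positivity
  rw [Lp.norm_def, (Lp.memLp f).eLpNorm_eq_integral_rpow_norm hp0 hp,
    ENNReal.toReal_ofReal (by positivity), ← Real.rpow_mul hI, inv_mul_cancel₀ h0.ne',
    Real.rpow_one]

theorem Lp_integrable_norm_rpow {E : Type*} [NormedAddCommGroup E] {p : ℝ≥0∞} (hp0 : p ≠ 0)
    (hp : p ≠ ∞) (f : Lp E p μ) : Integrable (fun x => ‖f x‖ ^ p.toReal) μ :=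
  (Lp.memLp f).integrable_norm_rpow hp0 hp

theorem isPowerSmooth_Lp_of_le_two {p : ℝ≥0∞} [hp1 : Fact (1 ≤ p)] (hp2 : p ≤ 2) :
    IsPowerSmooth (Lp 𝕜 p μ) p.toReal 2 := by
  intro f g
  have hp : p ≠ ∞ := ne_top_of_le_ne_top (by simp) hp2
  have hp0 : p ≠ 0 := (one_pos.trans_le hp1.out).ne'
  have h0 : 0 < p.toReal := ENNReal.toReal_pos hp0 hp
  have h2 : p.toReal ≤ 2 := by simpa using ENNReal.toReal_mono (by simp) hp2
  have hI := fun f : Lp 𝕜 p μ => Lp_integrable_norm_rpow hp0 hp f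
  simp only [Lp_norm_rpow_eq_integral hp0 hp]
  rw [← integral_const_mul, ← integral_const_mul, ← integral_add (hI _) (hI _),
    ← integral_add ((hI _).const_mul _) ((hI _).const_mul _)]
  refine integral_mono_ae ((hI _).add (hI _)) (((hI _).const_mul _).add ((hI _).const_mul _)) ?_
  filter_upwards [Lp.coeFn_add f g, Lp.coeFn_sub f g] with x hx hy
  rw [hx, hy]
  exact norm_add_rpow_add_norm_sub_rpow_le h0 h2 _ _

/-- Triangle inequality in `L_{p/2}` for `|f|²` and `K |g|²`. -/
theorem integral_rpow_sq_add_sq_le {p : ℝ≥0∞} [Fact (1 ≤ p)] (hp : p ≠ ∞) (hp2 : 2 ≤ p) {K : ℝ}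
    (hK : 0 ≤ K) (f g : Lp 𝕜 p μ) :
    Integrable (fun x => (‖f x‖ ^ 2 + K * ‖g x‖ ^ 2) ^ (p.toReal / 2)) μ ∧
    ∫ x, (‖f x‖ ^ 2 + K * ‖g x‖ ^ 2) ^ (p.toReal / 2) ∂μ ≤
      (‖f‖ ^ 2 + K * ‖g‖ ^ 2) ^ (p.toReal / 2) := by
  have hp0 : p ≠ 0 := (two_pos.trans_le hp2).ne'
  have hs : (p / 2).toReal = p.toReal / 2 := by simp
  have hs1 : Fact (1 ≤ p / 2) := ⟨by
    rw [ENNReal.le_div_iff_mul_le (by simp) (by simp), one_mul]; exact hp2⟩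
  have hs0 : p / 2 ≠ 0 := (one_pos.trans_le hs1.out).ne'
  have hst : p / 2 ≠ ∞ := ENNReal.div_ne_top hp (by simp)
  have hs2 : 0 < p.toReal / 2 := hs ▸ ENNReal.toReal_pos hs0 hst
  have hmem : ∀ f : Lp 𝕜 p μ, MemLp (fun x => ‖f x‖ ^ 2) (p / 2) μ := by
    intro f
    simpa using (Lp.memLp f).norm_rpow_div 2
  have hnorm : ∀ f : Lp 𝕜 p μ, ‖(hmem f).toLp‖ = ‖f‖ ^ 2 := by
    intro f
    have h1 : ‖(hmem f).toLp‖ ^ (p / 2).toReal = (‖f‖ ^ 2) ^ (p / 2).toReal := by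
      rw [Lp_norm_rpow_eq_integral hs0 hst, hs, ← Real.rpow_two, ← Real.rpow_mul (norm_nonneg _),
        mul_div_cancel₀ _ two_ne_zero, Lp_norm_rpow_eq_integral hp0 hp]
      refine integral_congr_ae ?_
      filter_upwards [(hmem f).coeFn_toLp] with x hx
      rw [hx, norm_pow, norm_norm, ← Real.rpow_two, ← Real.rpow_mul (norm_nonneg _),
        mul_div_cancel₀ _ two_ne_zero]
    exact (Real.rpow_left_inj (norm_nonneg _) (by positivity) (by rw [hs]; exact hs2.ne')).mp h1
  set F := (hmem f).toLp + K • (hmem g).toLp with hF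
  have hFx : ∀ᵐ x ∂μ, ‖F x‖ ^ (p / 2).toReal =
      (‖f x‖ ^ 2 + K * ‖g x‖ ^ 2) ^ (p.toReal / 2) := by
    filter_upwards [Lp.coeFn_add (hmem f).toLp (K • (hmem g).toLp),
      Lp.coeFn_smul K (hmem g).toLp, (hmem f).coeFn_toLp, (hmem g).coeFn_toLp] with x h1 h2 h3 h4
    rw [hF, h1, Pi.add_apply, h2, Pi.smul_apply, h3, h4, hs, smul_eq_mul, Real.norm_of_nonneg]
    positivity
  refine ⟨(Lp_integrable_norm_rpow hs0 hst F).congr hFx, ?_⟩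
  rw [← integral_congr_ae hFx, ← Lp_norm_rpow_eq_integral hs0 hst, hs]
  gcongr
  refine (norm_add_le _ _).trans ?_
  rw [norm_smul, hnorm, hnorm, Real.norm_of_nonneg hK]

/-- Integrating the scalar inequality compares `p`-th powers; convexity of `t^(p/2)` then allows a
`p/2`-th root, leaving squares. -/
theorem isPowerSmooth_Lp_of_two_le {p : ℝ≥0∞} [Fact (1 ≤ p)] (hp : p ≠ ∞) (hp2 : 2 ≤ p) :
    IsPowerSmooth (Lp 𝕜 p μ) 2 (2 * Real.exp p.toReal) := by
  intro f g
  have hp0 : p ≠ 0 := (two_pos.trans_le hp2).ne'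
  have h2 : 2 ≤ p.toReal := by simpa using ENNReal.toReal_mono hp hp2
  have hI := fun f : Lp 𝕜 p μ => Lp_integrable_norm_rpow hp0 hp f
  obtain ⟨hint, hle⟩ := integral_rpow_sq_add_sq_le hp hp2 (Real.exp_pos p.toReal).le f g
  have hpow : ∀ x : ℝ, 0 ≤ x → (x ^ 2) ^ (p.toReal / 2) = x ^ p.toReal := by
    intro x hx
    rw [← Real.rpow_two, ← Real.rpow_mul hx]
    congr 1; ring
  have h1 : ‖f + g‖ ^ p.toReal + ‖f - g‖ ^ p.toReal ≤
      2 * (‖f‖ ^ 2 + Real.exp p.toReal * ‖g‖ ^ 2) ^ (p.toReal / 2) := by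
    refine le_trans ?_ (mul_le_mul_of_nonneg_left hle two_pos.le)
    rw [Lp_norm_rpow_eq_integral hp0 hp, Lp_norm_rpow_eq_integral hp0 hp,
      ← integral_add (hI _) (hI _), ← integral_const_mul]
    refine integral_mono_ae ((hI _).add (hI _)) (hint.const_mul 2) ?_
    filter_upwards [Lp.coeFn_add f g, Lp.coeFn_sub f g] with x hx hy
    rw [hx, hy]
    exact norm_add_rpow_add_norm_sub_rpow_le_of_two_le h2 _ _
  have h3 := rpow_midpoint_le (x := ‖f + g‖ ^ 2) (y := ‖f - g‖ ^ 2) (by positivity) (by positivity)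
    (show 1 ≤ p.toReal / 2 by linarith)
  rw [hpow _ (norm_nonneg _), hpow _ (norm_nonneg _)] at h3
  have h4 : (1 / 2 * ‖f + g‖ ^ 2 + 1 / 2 * ‖f - g‖ ^ 2) ^ (p.toReal / 2) ≤
      (‖f‖ ^ 2 + Real.exp p.toReal * ‖g‖ ^ 2) ^ (p.toReal / 2) := by linarith
  have h5 := (Real.rpow_le_rpow_iff (by positivity) (by positivity) (by positivity)).mp h4
  simp only [Real.rpow_two]
  linarith

/-- Groups whose equivariant `L_p` compression exponent exceeds `max (1/2) (1/p)` are amenable. -/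
theorem isAmenable_of_lt_lpEquivariantCompressionExponent {G : Type*} [Group G] {S : Set G}
    (hS : IsSymmGenSet S) {p : ℝ≥0∞} [hp1 : Fact (1 ≤ p)] (hp : p ≠ ∞)
    (h : max (1 / 2) (1 / p) < lpEquivariantCompressionExponent 𝕜 p S) : IsAmenable G := by
  rw [lpEquivariantCompressionExponent, equivariantCompressionExponent] at h
  simp only [lt_iSup_iff] at h
  obtain ⟨α, hα, hlt⟩ := h
  have hp0 : p ≠ 0 := (one_pos.trans_le hp1.out).ne'
  have hp0' : 0 < p.toReal := ENNReal.toReal_pos hp0 hp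
  rw [max_lt_iff] at hlt
  rcases le_total p 2 with hp2 | hp2
  · refine isAmenable_of_hasEquivariantCompression hS ?_ (isPowerSmooth_Lp_of_le_two hp2) ?_ hα
    · simpa using ENNReal.toReal_mono hp hp1.out
    · have := ENNReal.toReal_strict_mono (by simp) hlt.2
      simp only [one_div, ENNReal.toReal_inv, ENNReal.coe_toReal] at this
      rwa [inv_lt_iff_one_lt_mul₀ hp0'] at this
  · refine isAmenable_of_hasEquivariantCompression hS (by norm_num)
      (isPowerSmooth_Lp_of_two_le hp hp2) ?_ hα
    have := ENNReal.toReal_strict_mono (by simp) hlt.1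
    simp only [one_div, ENNReal.toReal_inv, ENNReal.toReal_ofNat, ENNReal.coe_toReal] at this
    linarith

end Lp

/-! ### Isometries between `L_p` spaces. -/

section LpIsometries

variable {𝕜 : Type*} [RCLike 𝕜] {p : ℝ≥0∞} [Fact (1 ≤ p)]
  {Ω Ω' : Type*} [MeasurableSpace Ω] [MeasurableSpace Ω'] {μ : Measure Ω} {ν : Measure Ω'}

/-- A measure preserving map which is invertible up to null sets induces an isometry of `L_p`. -/
theorem nonempty_lpEquiv_of_measurePreserving {φ : Ω → Ω'} {φ' : Ω' → Ω}
    (hφ : MeasurePreserving φ μ ν) (hφ' : MeasurePreserving φ' ν μ) (h : φ' ∘ φ =ᵐ[μ] id) :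
    Nonempty (Lp 𝕜 p ν ≃ₗᵢ[𝕜] Lp 𝕜 p μ) := by
  refine ⟨LinearIsometryEquiv.ofSurjective (Lp.compMeasurePreservingₗᵢ 𝕜 φ hφ) fun f =>
    ⟨Lp.compMeasurePreserving φ' hφ' f, ?_⟩⟩
  refine Lp.ext ?_
  refine (Lp.coeFn_compMeasurePreserving _ hφ).trans ?_
  have h1 := hφ.quasiMeasurePreserving.ae_eq_comp (Lp.coeFn_compMeasurePreserving f hφ')
  filter_upwards [h1, h] with x h1 h2
  rw [h1]
  simpa using congrArg f h2

theorem eLpNorm_withDensity_smul {w : Ω → ℝ≥0} (hw : Measurable w) (hp : p ≠ ∞) (f : Ω → 𝕜) :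
    eLpNorm (fun x => (((w x : ℝ) ^ (p.toReal)⁻¹ : ℝ) : 𝕜) * f x) p μ =
      eLpNorm f p (μ.withDensity fun x => w x) := by
  have hp0 : p ≠ 0 := (one_pos.trans_le (Fact.out : 1 ≤ p)).ne'
  have h0 : 0 < p.toReal := ENNReal.toReal_pos hp0 hp
  rw [eLpNorm_eq_lintegral_rpow_enorm_toReal hp0 hp, eLpNorm_eq_lintegral_rpow_enorm_toReal hp0 hp,
    lintegral_withDensity_eq_lintegral_mul_non_measurable _ hw.coe_nnreal_ennreal
      (Filter.Eventually.of_forall fun x => ENNReal.coe_lt_top)]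
  congr 1
  refine lintegral_congr fun x => ?_
  rw [enorm_mul, ENNReal.mul_rpow_of_nonneg _ _ h0.le, Pi.mul_apply]
  congr 1
  rw [← ofReal_norm, RCLike.norm_ofReal, abs_of_nonneg (by positivity),
    ENNReal.ofReal_rpow_of_nonneg (by positivity) h0.le, ← Real.rpow_mul (by positivity),
    inv_mul_cancel₀ h0.ne', Real.rpow_one, ENNReal.ofReal_coe_nnreal]

theorem memLp_withDensity_smul_iff {w : Ω → ℝ≥0} (hw : Measurable w) (hw0 : ∀ x, 0 < w x)
    (hp : p ≠ ∞) (f : Ω → 𝕜) :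
    MemLp (fun x => (((w x : ℝ) ^ (p.toReal)⁻¹ : ℝ) : 𝕜) * f x) p μ ↔
      MemLp f p (μ.withDensity fun x => w x) := by
  have hw' : Measurable fun x => (((w x : ℝ) ^ (p.toReal)⁻¹ : ℝ) : 𝕜) := by fun_prop
  have hac : μ ≪ μ.withDensity fun x => (w x : ℝ≥0∞) :=
    withDensity_absolutelyContinuous' hw.coe_nnreal_ennreal.aemeasurable
      (Filter.Eventually.of_forall fun x => by simpa using (hw0 x).ne')
  have hac' : (μ.withDensity fun x => (w x : ℝ≥0∞)) ≪ μ := withDensity_absolutelyContinuous _ _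
  rw [MemLp, MemLp, eLpNorm_withDensity_smul hw hp]
  refine and_congr_left fun _ => ⟨fun h => ?_, fun h => ?_⟩
  · have h1 := (hw'.inv.aestronglyMeasurable (μ := μ)).mul h
    refine (h1.congr (Filter.Eventually.of_forall fun x => ?_)).mono_ac hac'
    have : (((w x : ℝ) ^ (p.toReal)⁻¹ : ℝ) : 𝕜) ≠ 0 := by
      have := hw0 x
      exact_mod_cast (by positivity : ((w x : ℝ) ^ (p.toReal)⁻¹) ≠ 0)
    simp [this]
  · exact (hw'.aestronglyMeasurable (μ := μ)).mul (h.mono_ac hac)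

/-- Changing the measure by a positive density does not change `L_p` up to isometry. -/
theorem nonempty_lpEquiv_withDensity {w : Ω → ℝ≥0} (hw : Measurable w) (hw0 : ∀ x, 0 < w x)
    (hp : p ≠ ∞) : Nonempty (Lp 𝕜 p (μ.withDensity fun x => w x) ≃ₗᵢ[𝕜] Lp 𝕜 p μ) := by
  have hac : μ ≪ μ.withDensity fun x => (w x : ℝ≥0∞) :=
    withDensity_absolutelyContinuous' hw.coe_nnreal_ennreal.aemeasurable
      (Filter.Eventually.of_forall fun x => by simpa using (hw0 x).ne')
  have hne : ∀ x, (((w x : ℝ) ^ (p.toReal)⁻¹ : ℝ) : 𝕜) ≠ 0 := fun x => by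
    have := hw0 x
    exact_mod_cast (by positivity : ((w x : ℝ) ^ (p.toReal)⁻¹) ≠ 0)
  have hmem := fun f : Lp 𝕜 p (μ.withDensity fun x => w x) =>
    (memLp_withDensity_smul_iff hw hw0 hp f).mpr (Lp.memLp f)
  let L : Lp 𝕜 p (μ.withDensity fun x => w x) →ₗᵢ[𝕜] Lp 𝕜 p μ :=
    { toFun := fun f => (hmem f).toLp
      map_add' := fun f g => by
        rw [← MemLp.toLp_add]
        refine MemLp.toLp_congr _ _ ?_
        filter_upwards [hac (Lp.coeFn_add f g)] with x hx
        rw [hx]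
        simp [mul_add]
      map_smul' := fun c f => by
        rw [RingHom.id_apply, ← MemLp.toLp_const_smul]
        refine MemLp.toLp_congr _ _ ?_
        filter_upwards [hac (Lp.coeFn_smul c f)] with x hx
        rw [hx]
        simp [mul_left_comm]
      norm_map' := fun f => by
        change ‖(hmem f).toLp‖ = ‖f‖
        rw [Lp.norm_toLp, eLpNorm_withDensity_smul hw hp, Lp.norm_def] }
  refine ⟨LinearIsometryEquiv.ofSurjective L fun f => ?_⟩
  have hf : MemLp (fun x => (((w x : ℝ) ^ (p.toReal)⁻¹ : ℝ) : 𝕜)⁻¹ * f x) p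
      (μ.withDensity fun x => w x) := by
    rw [← memLp_withDensity_smul_iff hw hw0 hp]
    refine (Lp.memLp f).congr_norm (Lp.memLp f).1 ?_ |>.ae_eq ?_
    · exact Filter.Eventually.of_forall fun x => rfl
    · exact Filter.Eventually.of_forall fun x => (mul_inv_cancel_left₀ (hne x) _).symm
  refine ⟨hf.toLp, Lp.ext ?_⟩
  refine (hmem hf.toLp).coeFn_toLp.trans ?_
  filter_upwards [hac hf.coeFn_toLp] with x hx
  rw [hx, mul_inv_cancel_left₀ (hne x)]

end LpIsometries

/-! ### Transport of an atomless measure on the interval to Lebesgue measure. -/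

section Quantile

open unitInterval Set Filter Topology

variable (μ : Measure I) [IsProbabilityMeasure μ]

/-- The distribution function of a probability measure on the unit interval. -/
noncomputable def distFun (x : I) : I := ⟨μ.real (Iic x), measureReal_nonneg, measureReal_le_one⟩

/-- The quantile function of a probability measure on the unit interval. -/
noncomputable def quantile (t : I) : I := sInf {x | t ≤ distFun μ x}

theorem monotone_distFun : Monotone (distFun μ) := fun _ _ h =>
  Subtype.mk_le_mk.mpr (measureReal_mono (Iic_subset_Iic.mpr h))

theorem distFun_top : distFun μ ⊤ = ⊤ := by
  refine Subtype.ext ?_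
  simp [distFun]

/-- The distribution function is right-continuous, so the infimum is attained. -/
theorem le_distFun_quantile (t : I) : t ≤ distFun μ (quantile μ t) := by
  have hne : {x | t ≤ distFun μ x}.Nonempty := ⟨⊤, by simp [distFun_top]⟩
  obtain ⟨u, hu, hlim, hmem⟩ := exists_seq_tendsto_sInf hne (OrderBot.bddBelow _)
  have hinter : ⋂ n, Iic (u n) = Iic (quantile μ t) := by
    ext x
    simp only [mem_iInter, mem_Iic]
    exact ⟨fun h => ge_of_tendsto' hlim h, fun h n => h.trans (sInf_le (hmem n))⟩
  have h1 := tendsto_measure_iInter_atTop (μ := μ) (s := fun n => Iic (u n))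
    (fun n => measurableSet_Iic.nullMeasurableSet) (fun _ _ h => Iic_subset_Iic.mpr (hu h))
    ⟨0, measure_ne_top _ _⟩
  rw [hinter] at h1
  have h2 := (ENNReal.tendsto_toReal (measure_ne_top μ _)).comp h1
  refine Subtype.coe_le_coe.mp (ge_of_tendsto' h2 fun n => ?_)
  have : t ≤ distFun μ (u n) := hmem n
  exact Subtype.coe_le_coe.mpr this

theorem quantile_le_iff (t x : I) : quantile μ t ≤ x ↔ t ≤ distFun μ x :=
  ⟨fun h => (le_distFun_quantile μ t).trans (monotone_distFun μ h), fun h => sInf_le h⟩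

theorem monotone_quantile : Monotone (quantile μ) := fun _ _ h =>
  (quantile_le_iff μ _ _).mpr (h.trans (le_distFun_quantile μ _))

/-- Points below the quantile have distribution value below `t`; without atoms this passes to the
limit from the left. -/
theorem distFun_quantile [NullSingletonClass μ] (t : I) : distFun μ (quantile μ t) = t := by
  refine le_antisymm ?_ (le_distFun_quantile μ t)
  rw [← Subtype.coe_le_coe]
  change (μ (Iic (quantile μ t))).toReal ≤ t
  rcases eq_bot_or_bot_lt (quantile μ t) with h0 | h0
  · rw [h0, Iic_bot, measure_singleton, ENNReal.toReal_zero]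
    exact t.2.1
  · obtain ⟨u, hu, hmem, hlim⟩ := exists_seq_strictMono_tendsto' h0
    have hunion : ⋃ n, Iic (u n) = Iio (quantile μ t) := by
      ext x
      simp only [mem_iUnion, mem_Iic, mem_Iio]
      refine ⟨fun ⟨n, hn⟩ => hn.trans_lt (hmem n).2, fun h => ?_⟩
      obtain ⟨n, hn⟩ := (hlim.eventually (lt_mem_nhds h)).exists
      exact ⟨n, hn.le⟩
    have h1 := tendsto_measure_iUnion_atTop (μ := μ) (s := fun n => Iic (u n))
      fun _ _ h => Iic_subset_Iic.mpr (hu.monotone h)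
    rw [hunion, measure_congr Iio_ae_eq_Iic] at h1
    have h2 := (ENNReal.tendsto_toReal (measure_ne_top μ _)).comp h1
    refine le_of_tendsto' h2 fun n => ?_
    have : ¬ t ≤ distFun μ (u n) := fun h =>
      absurd ((quantile_le_iff μ t (u n)).mpr h) (not_le.mpr (hmem n).2)
    exact Subtype.coe_le_coe.mpr (not_le.mp this).le

theorem measurePreserving_quantile : MeasurePreserving (quantile μ) volume μ := by
  refine ⟨(monotone_quantile μ).measurable, ?_⟩
  have := Measure.isProbabilityMeasure_map (μ := (volume : Measure I))
    (monotone_quantile μ).measurable.aemeasurable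
  refine Measure.ext_of_Iic _ _ fun x => ?_
  rw [Measure.map_apply (monotone_quantile μ).measurable measurableSet_Iic]
  have : quantile μ ⁻¹' Iic x = Iic (distFun μ x) := by
    ext t; exact quantile_le_iff μ t x
  rw [this, unitInterval.volume_Iic]
  simp [distFun]

theorem measurePreserving_distFun [NullSingletonClass μ] : MeasurePreserving (distFun μ) μ volume := by
  refine ⟨(monotone_distFun μ).measurable, ?_⟩
  have h := congrArg (Measure.map (distFun μ)) (measurePreserving_quantile μ).map_eq
  rw [← h, Measure.map_map (monotone_distFun μ).measurable (monotone_quantile μ).measurable]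
  have : distFun μ ∘ quantile μ = id := funext (distFun_quantile μ)
  rw [this, Measure.map_id]

end Quantile

/-! ### Atomless standard Borel spaces. -/

section Atomless

variable {𝕜 : Type*} [RCLike 𝕜] {p : ℝ≥0∞} [Fact (1 ≤ p)]
  {Ω : Type*} [MeasurableSpace Ω] [StandardBorelSpace Ω]

theorem nonempty_lpEquiv_unitInterval_of_isProbabilityMeasure (μ : Measure Ω)
    [IsProbabilityMeasure μ] [NullSingletonClass μ] :
    Nonempty (Lp 𝕜 p μ ≃ₗᵢ[𝕜] Lp 𝕜 p (volume : Measure unitInterval)) := by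
  have hΩ : ¬ Countable Ω := fun h => by
    have h1 : μ Set.univ = 0 := Set.countable_univ.measure_zero μ
    simp at h1
  have hI : ¬ Countable unitInterval := fun h => by
    have h1 : (volume : Measure unitInterval) Set.univ = 0 := Set.countable_univ.measure_zero _
    simp at h1
  let e : Ω ≃ᵐ unitInterval := PolishSpace.measurableEquivOfNotCountable hΩ hI
  have he : MeasurePreserving e μ (μ.map e) := ⟨e.measurable, rfl⟩
  have : IsProbabilityMeasure (μ.map e) := Measure.isProbabilityMeasure_map e.measurable.aemeasurable
  have : NullSingletonClass (μ.map e) := ⟨fun x => by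
    rw [e.map_apply, ← e.image_symm, Set.image_singleton, measure_singleton]⟩
  have he' : MeasurePreserving e.symm (μ.map e) μ := he.symm e
  obtain ⟨f⟩ := nonempty_lpEquiv_of_measurePreserving (𝕜 := 𝕜) (p := p) he' he
    (Filter.Eventually.of_forall fun x => by simp)
  obtain ⟨g⟩ := nonempty_lpEquiv_of_measurePreserving (𝕜 := 𝕜) (p := p)
    (measurePreserving_quantile (μ.map e)) (measurePreserving_distFun (μ.map e))
    (Filter.Eventually.of_forall (distFun_quantile (μ.map e)))
  exact ⟨f.trans g⟩

/-- All `L_p` spaces of atomless σ-finite standard Borel spaces are isometric to `L_p([0, 1])`. -/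
theorem nonempty_lpEquiv_unitInterval (hp : p ≠ ∞) (μ : Measure Ω) [SigmaFinite μ] [NullSingletonClass μ]
    (hμ : μ ≠ 0) : Nonempty (Lp 𝕜 p μ ≃ₗᵢ[𝕜] Lp 𝕜 p (volume : Measure unitInterval)) := by
  -- A positive integrable density, once normalised, replaces `μ` by an equivalent probability
  -- measure.
  obtain ⟨w, hw0, hw, hlt⟩ := exists_pos_lintegral_lt_of_sigmaFinite μ one_ne_zero
  have hpos : (∫⁻ x, w x ∂μ) ≠ 0 := by
    rw [Ne, lintegral_eq_zero_iff hw.coe_nnreal_ennreal]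
    intro h
    refine hμ (ae_eq_bot.mp (Filter.eventually_false_iff_eq_bot.mp ?_))
    filter_upwards [h] with x hx
    exact (hw0 x).ne' (by simpa using hx)
  have hfin : (∫⁻ x, w x ∂μ) ≠ ∞ := (hlt.trans ENNReal.one_lt_top).ne
  set c : ℝ≥0 := (∫⁻ x, w x ∂μ).toNNReal with hc
  have hc' : (c : ℝ≥0∞) = ∫⁻ x, w x ∂μ := ENNReal.coe_toNNReal hfin
  have hc0 : c ≠ 0 := by
    intro h; rw [h] at hc'; exact hpos hc'.symm
  have hw' : Measurable fun x => c⁻¹ * w x := hw.const_mul _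
  have hw0' : ∀ x, 0 < c⁻¹ * w x := fun x => mul_pos (inv_pos.mpr (pos_iff_ne_zero.mpr hc0)) (hw0 x)
  have : IsProbabilityMeasure (μ.withDensity fun x => ((c⁻¹ * w x : ℝ≥0) : ℝ≥0∞)) := ⟨by
    rw [withDensity_apply _ MeasurableSet.univ, Measure.restrict_univ]
    simp only [ENNReal.coe_mul]
    rw [lintegral_const_mul _ hw.coe_nnreal_ennreal, ← hc', ← ENNReal.coe_mul,
      inv_mul_cancel₀ hc0, ENNReal.coe_one]⟩
  have : NullSingletonClass (μ.withDensity fun x => ((c⁻¹ * w x : ℝ≥0) : ℝ≥0∞)) :=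
    ⟨fun x => withDensity_absolutelyContinuous _ _ (measure_singleton x)⟩
  obtain ⟨f⟩ := nonempty_lpEquiv_withDensity (𝕜 := 𝕜) (p := p) (μ := μ) hw' hw0' hp
  obtain ⟨g⟩ := nonempty_lpEquiv_unitInterval_of_isProbabilityMeasure (𝕜 := 𝕜) (p := p)
    (μ.withDensity fun x => ((c⁻¹ * w x : ℝ≥0) : ℝ≥0∞))
  exact ⟨f.symm.trans g⟩

end Atomless

/-! ### The edge cocycle of the Cayley tree. -/

section FreeGroupTree

open FreeGroup

theorem mk_false {α : Type*} (j : α) : (mk [(j, false)] : FreeGroup α) = (of j)⁻¹ := by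
  rw [of, inv_mk]; rfl

variable {α : Type*} [DecidableEq α]

theorem one_notMem_startsWith (w : α × Bool) : (1 : FreeGroup α) ∉ startsWith w := fun h =>
  startsWith.ne_one _ h rfl

theorem toWord_mul_of_of_getLast?_ne {y : FreeGroup α} {j : α}
    (h : y.toWord.getLast? ≠ some (j, false)) : (y * of j).toWord = y.toWord ++ [(j, true)] := by
  rw [toWord_mul, toWord_of]
  refine IsReduced.reduce_eq ?_
  refine List.isChain_append.mpr ⟨isReduced_toWord, by simp, fun a ha b hb => ?_⟩
  rintro h1
  simp only [List.head?_cons, Option.mem_def, Option.some.injEq] at hb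
  subst hb
  by_contra h2
  refine h ?_
  rw [Option.mem_def.mp ha]
  rcases a with ⟨i, b⟩
  simp_all

theorem toWord_mul_of_of_eq_append {y : FreeGroup α} {j : α} {L : List (α × Bool)}
    (h : y.toWord = L ++ [(j, false)]) : (y * of j).toWord = L := by
  have hred : IsReduced (L ++ [(j, false)]) := h ▸ isReduced_toWord
  have hL : IsReduced L := (List.isChain_append.mp hred).1
  have : y * of j = mk L := by
    rw [← mk_toWord (x := y), h, ← mul_mk, mul_assoc]
    rw [mk_false, inv_mul_cancel, mul_one]
  rw [this, toWord_mk, hL.reduce_eq]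

/-- Multiplying a nontrivial element on the right by a generator does not change whether its
reduced word starts with a positive letter. -/
theorem mul_of_mem_startsWith_iff {y : FreeGroup α} (hy : y ≠ 1) (i j : α) :
    y * of j ∈ startsWith (i, true) ↔ y ∈ startsWith (i, true) := by
  simp only [startsWith, Set.mem_ofPred_eq]
  have hne : y.toWord ≠ [] := by rwa [Ne, toWord_eq_nil_iff]
  by_cases h : y.toWord.getLast? = some (j, false)
  · obtain ⟨L, hL⟩ : ∃ L, y.toWord = L ++ [(j, false)] :=
      ⟨y.toWord.dropLast, (List.dropLast_append_getLast? _ h).symm⟩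
    rw [toWord_mul_of_of_eq_append hL, hL]
    cases L with
    | nil => simp
    | cons a L => simp
  · rw [toWord_mul_of_of_getLast?_ne h]
    cases hw : y.toWord with
    | nil => exact absurd hw hne
    | cons a L => simp

open Classical in
/-- The tree cocycle of the free group: the signed number of crossings of the edge
`(h, h * of i)` by the path from `1` to `x`. -/
noncomputable def treeCocycle (x : FreeGroup α) (e : FreeGroup α × α) : ℤ :=
  (if e.1⁻¹ * x ∈ startsWith (e.2, true) then 1 else 0) -
    (if e.1⁻¹ ∈ startsWith (e.2, true) then 1 else 0)

theorem treeCocycle_one (e : FreeGroup α × α) : treeCocycle 1 e = 0 := by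
  classical
  simp [treeCocycle]

/-- The cocycle is a formal coboundary, a difference of translates of an indicator, so the sum
telescopes. -/
theorem treeCocycle_mul (x y : FreeGroup α) (e : FreeGroup α × α) :
    treeCocycle (x * y) e = treeCocycle y (x⁻¹ * e.1, e.2) + treeCocycle x e := by
  classical
  simp only [treeCocycle, mul_inv_rev, inv_inv, mul_assoc]
  ring

theorem treeCocycle_mem (x : FreeGroup α) (e : FreeGroup α × α) :
    treeCocycle x e = -1 ∨ treeCocycle x e = 0 ∨ treeCocycle x e = 1 := by
  unfold treeCocycle
  split_ifs <;> simp

theorem treeCocycle_of (j : α) (e : FreeGroup α × α) :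
    treeCocycle (of j) e = if e = (1, j) then 1 else 0 := by
  classical
  rcases e with ⟨h, i⟩
  simp only [treeCocycle, Prod.mk.injEq]
  rcases eq_or_ne h 1 with rfl | hh
  · simp only [inv_one, one_mul, one_notMem_startsWith, if_false, sub_zero, true_and]
    refine if_congr ?_ rfl rfl
    simp only [startsWith, Set.mem_ofPred_eq, toWord_of]
    simp [eq_comm]
  · simp only [mul_of_mem_startsWith_iff (inv_ne_one.mpr hh), sub_self, hh, false_and, if_false]

theorem treeCocycle_inv (x : FreeGroup α) (e : FreeGroup α × α) :
    treeCocycle x⁻¹ e = - treeCocycle x (x * e.1, e.2) := by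
  have h := treeCocycle_mul x x⁻¹ (x * e.1, e.2)
  rw [mul_inv_cancel, treeCocycle_one, inv_mul_cancel_left] at h
  linarith

theorem treeCocycle_support_finite (x : FreeGroup α) : (treeCocycle x).support.Finite := by
  have hof : ∀ j : α, (treeCocycle (of j)).support.Finite := fun j => by
    refine (Set.finite_singleton ((1 : FreeGroup α), j)).subset fun e he => ?_
    by_contra h
    exact he (by rw [treeCocycle_of, if_neg (by simpa using h)])
  induction x using FreeGroup.induction_on with
  | C1 =>
    have : (treeCocycle (1 : FreeGroup α)) = 0 := funext treeCocycle_one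
    simp [this]
  | of j => exact hof j
  | inv_of j _ =>
    refine ((hof j).image fun e => ((of j)⁻¹ * e.1, e.2)).subset fun e he => ?_
    refine ⟨(of j * e.1, e.2), ?_, by simp⟩
    rw [Function.mem_support, treeCocycle_inv, neg_ne_zero] at he
    exact he
  | mul x y hx hy =>
    refine (hx.union (hy.image fun e => (x * e.1, e.2))).subset fun e he => ?_
    by_contra h
    simp only [Set.mem_union, not_or, Function.mem_support, not_not] at h
    refine he ?_
    rw [treeCocycle_mul, h.1, add_zero]
    by_contra h2
    exact h.2 ⟨(x⁻¹ * e.1, e.2), h2, by simp⟩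

/-- The edges crossed by the path from `1` to `x`. -/
noncomputable def treePath (x : FreeGroup α) : Finset (FreeGroup α × α) :=
  (treeCocycle_support_finite x).toFinset

theorem mem_treePath {x : FreeGroup α} {e : FreeGroup α × α} :
    e ∈ treePath x ↔ treeCocycle x e ≠ 0 := by
  simp [treePath]

/-- The first edge of a path starting at `1` in the direction of the letter `s`. -/
def firstEdge (s : α × Bool) : FreeGroup α × α := (if s.2 then 1 else (of s.1)⁻¹, s.1)

theorem treeCocycle_mk_singleton_ne_zero_iff (s : α × Bool) (e : FreeGroup α × α) :
    treeCocycle (mk [s]) e ≠ 0 ↔ e = firstEdge s := by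
  rcases s with ⟨j, b⟩
  cases b
  · rw [mk_false, treeCocycle_inv, neg_ne_zero, treeCocycle_of]
    simp [firstEdge, Prod.ext_iff, mul_eq_one_iff_inv_eq, eq_comm]
  · have : (mk [(j, true)] : FreeGroup α) = of j := rfl
    rw [this, treeCocycle_of]
    simp [firstEdge]

theorem treeCocycle_firstEdge_eq_zero {s : α × Bool} {y : FreeGroup α}
    (h : y ∉ startsWith (s.1, !s.2)) :
    treeCocycle y ((mk [s])⁻¹ * (firstEdge s).1, (firstEdge s).2) = 0 := by
  classical
  rcases s with ⟨j, b⟩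
  cases b
  · simp only [mk_false, inv_inv, firstEdge, treeCocycle]
    simp only [Bool.not_false] at h
    simp [h, one_notMem_startsWith]
  · have e1 : (mk [(j, true)] : FreeGroup α) = of j := rfl
    simp only [Bool.not_true] at h
    have h1 : of j * y ∈ startsWith (j, true) := startsWith_mk_mul (w := (j, true)) y h
    have h2 : of j * 1 ∈ startsWith (j, true) :=
      startsWith_mk_mul (w := (j, true)) 1 (one_notMem_startsWith _)
    rw [mul_one] at h2
    simp [e1, firstEdge, treeCocycle, h1, h2]

/-- A new first letter translates the old path and adds one edge; reducedness keeps the translated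
path from crossing that edge back. -/
theorem card_treePath_mk {L : List (α × Bool)} (hL : IsReduced L) :
    (treePath (mk L)).card = L.length := by
  classical
  induction L with
  | nil =>
    rw [List.length_nil, Finset.card_eq_zero]
    ext e
    have : (mk [] : FreeGroup α) = 1 := rfl
    simp [mem_treePath, this, treeCocycle_one]
  | cons s L ih =>
    have hL' : IsReduced L := by
      have := List.isChain_append (l₁ := [s]) (l₂ := L).mp hL
      exact this.2.1
    set y : FreeGroup α := mk L with hy
    have hys : y ∉ startsWith (s.1, !s.2) := by
      simp only [startsWith, Set.mem_ofPred_eq, hy, toWord_mk, hL'.reduce_eq]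
      cases L with
      | nil => simp
      | cons t L =>
        have h1 := (isReduced_cons_cons.mp hL).1
        rintro h2
        simp only [List.getElem?_cons_zero, Option.some.injEq] at h2
        subst h2
        simpa using h1 rfl
    have hmk : (mk (s :: L) : FreeGroup α) = mk [s] * y := by rw [hy, mul_mk]; rfl
    have hz := treeCocycle_firstEdge_eq_zero hys
    let σ : FreeGroup α × α ↪ FreeGroup α × α :=
      ⟨fun e => (mk [s] * e.1, e.2), fun e e' h => by
        simp only [Prod.mk.injEq, mul_right_inj] at h
        exact Prod.ext h.1 h.2⟩
    have hset : treePath (mk (s :: L)) = insert (firstEdge s) ((treePath y).map σ) := by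
      ext e
      rw [Finset.mem_insert, mem_treePath, hmk, treeCocycle_mul]
      have h2 : e ∈ (treePath y).map σ ↔ treeCocycle y ((mk [s])⁻¹ * e.1, e.2) ≠ 0 := by
        simp only [Finset.mem_map, mem_treePath]
        constructor
        · rintro ⟨e', he', rfl⟩
          change treeCocycle y ((mk [s])⁻¹ * (mk [s] * e'.1), e'.2) ≠ 0
          rwa [inv_mul_cancel_left]
        · intro h
          exact ⟨_, h, Prod.ext (mul_inv_cancel_left _ _) rfl⟩
      rw [h2]
      by_cases he : e = firstEdge s
      · have h3 := (treeCocycle_mk_singleton_ne_zero_iff s e).mpr he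
        have h4 : treeCocycle y ((mk [s])⁻¹ * e.1, e.2) = 0 := by rw [he]; exact hz
        simp only [he, true_or, iff_true]
        rw [← he, h4, zero_add]
        exact h3
      · have h3 : treeCocycle (mk [s]) e = 0 := by
          by_contra h
          exact he ((treeCocycle_mk_singleton_ne_zero_iff s e).mp h)
        simp [he, h3]
    rw [hset, Finset.card_insert_of_notMem, Finset.card_map, ih hL', List.length_cons]
    simp only [Finset.mem_map, mem_treePath]
    rintro ⟨e', he', h⟩
    refine he' ?_
    rw [← hz, ← h]
    change treeCocycle y e' = treeCocycle y ((mk [s])⁻¹ * (mk [s] * e'.1), e'.2)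
    rw [inv_mul_cancel_left]

theorem card_treePath (x : FreeGroup α) : (treePath x).card = x.norm := by
  conv_lhs => rw [← mk_toWord (x := x)]
  exact card_treePath_mk isReduced_toWord

end FreeGroupTree

/-! ### Isometric representations on `L_p`. -/

section Representations

variable {𝕜 : Type*} [RCLike 𝕜] {G : Type*} [Group G]

/-- Conjugation of a linear isometric representation by a linear isometry. -/
def conjRep {X Y : Type*} [NormedAddCommGroup X] [NormedSpace 𝕜 X] [NormedAddCommGroup Y]
    [NormedSpace 𝕜 Y] (Φ : X ≃ₗᵢ[𝕜] Y) (π : G →* (X ≃ₗᵢ[𝕜] X)) : G →* (Y ≃ₗᵢ[𝕜] Y) where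
  toFun g := Φ.symm.trans ((π g).trans Φ)
  map_one' := by ext y; simp
  map_mul' g h := by ext y; simp [LinearIsometryEquiv.coe_mul]

variable {Ω : Type*} [MeasurableSpace Ω] {μ : Measure Ω} {p : ℝ≥0∞} [Fact (1 ≤ p)]

/-- The Koopman representation on `L_p` of a measure preserving action. -/
noncomputable def koopman (𝕜 : Type*) [RCLike 𝕜] (p : ℝ≥0∞) [Fact (1 ≤ p)]
    (τ : G → Ω → Ω) (hτ : ∀ g, MeasurePreserving (τ g) μ μ) (τ_one : τ 1 = id)
    (τ_mul : ∀ g h, τ (g * h) = τ g ∘ τ h) : G →* (Lp 𝕜 p μ ≃ₗᵢ[𝕜] Lp 𝕜 p μ) :=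
  have hcomp : ∀ (g h : G) (f : Lp 𝕜 p μ),
      Lp.compMeasurePreserving (τ h) (hτ h) (Lp.compMeasurePreserving (τ g) (hτ g) f) =
        Lp.compMeasurePreserving (τ (g * h)) (hτ (g * h)) f := fun g h f => by
    rw [← Lp.compMeasurePreserving_comp_apply]
    simp only [τ_mul]
  have hone : ∀ f : Lp 𝕜 p μ, Lp.compMeasurePreserving (τ 1) (hτ 1) f = f := fun f => by
    have : ∀ (T : Ω → Ω) (hT : MeasurePreserving T μ μ), T = id →
        Lp.compMeasurePreserving T hT f = f := by
      rintro T hT rfl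
      exact Lp.compMeasurePreserving_id_apply f
    exact this _ _ τ_one
  have hinv : ∀ (a b : G) (f : Lp 𝕜 p μ), a * b = 1 →
      Lp.compMeasurePreserving (τ b) (hτ b) (Lp.compMeasurePreserving (τ a) (hτ a) f) = f :=
    fun a b f h => by
      rw [hcomp]
      simp only [h]
      exact hone f
  { toFun := fun g =>
      { toLinearEquiv :=
          { toLinearMap := Lp.compMeasurePreservingₗ 𝕜 (τ g⁻¹) (hτ g⁻¹)
            invFun := Lp.compMeasurePreserving (τ g) (hτ g)
            left_inv := fun f => hinv _ _ f (inv_mul_cancel g)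
            right_inv := fun f => hinv _ _ f (mul_inv_cancel g) }
        norm_map' := fun f => Lp.norm_compMeasurePreserving f (hτ g⁻¹) }
    map_one' := by
      ext1 f
      change Lp.compMeasurePreserving (τ 1⁻¹) (hτ 1⁻¹) f = f
      simp only [inv_one]
      exact hone f
    map_mul' := fun g h => by
      ext1 f
      change Lp.compMeasurePreserving (τ (g * h)⁻¹) (hτ (g * h)⁻¹) f =
        Lp.compMeasurePreserving (τ g⁻¹) (hτ g⁻¹) (Lp.compMeasurePreserving (τ h⁻¹) (hτ h⁻¹) f)
      rw [hcomp]
      simp only [mul_inv_rev] }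

theorem koopman_toLp (τ : G → Ω → Ω) (hτ : ∀ g, MeasurePreserving (τ g) μ μ) (τ_one : τ 1 = id)
    (τ_mul : ∀ g h, τ (g * h) = τ g ∘ τ h) (g : G) {f f' : Ω → 𝕜} (hf : MemLp f p μ) (hf' : MemLp f' p μ) (h : ∀ x, f (τ g⁻¹ x) = f' x) :
    koopman 𝕜 p τ hτ τ_one τ_mul g hf.toLp = hf'.toLp := by
  change Lp.compMeasurePreserving (τ g⁻¹) (hτ g⁻¹) hf.toLp = hf'.toLp
  rw [Lp.toLp_compMeasurePreserving hf (hτ g⁻¹)]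
  exact MemLp.toLp_congr _ _ (Filter.Eventually.of_forall h)

end Representations

/-! ### Families in `L_p([0, 1])` permuted by the group. -/

section Models

variable {𝕜 : Type*} [RCLike 𝕜] {G : Type*} [Group G] {E : Type*}
  {p : ℝ≥0∞} [Fact (1 ≤ p)]

/-- A family of vectors permuted by an isometric representation on which sums with signs have
norm at least `c * n ^ β`, `n` being the number of summands. -/
def HasPermutedFamily (𝕜 : Type*) [RCLike 𝕜] {G : Type*} [Group G] {E : Type*}
    (σ : G →* Equiv.Perm E) (X : Type*) [NormedAddCommGroup X] [NormedSpace 𝕜 X] (c β : ℝ) : Prop :=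
  ∃ (π : G →* (X ≃ₗᵢ[𝕜] X)) (ξ : E → X), (∀ g e, π g (ξ e) = ξ (σ g e)) ∧
    ∀ (s : Finset E) (k : E → ℝ), (∀ e ∈ s, k e ^ 2 = 1) →
      c * (s.card : ℝ) ^ β ≤ ‖∑ e ∈ s, (k e : 𝕜) • ξ e‖

theorem HasPermutedFamily.of_equiv {σ : G →* Equiv.Perm E} {X Y : Type*} [NormedAddCommGroup X]
    [NormedSpace 𝕜 X] [NormedAddCommGroup Y] [NormedSpace 𝕜 Y] {c β : ℝ}
    (h : HasPermutedFamily 𝕜 σ X c β) (Φ : X ≃ₗᵢ[𝕜] Y) : HasPermutedFamily 𝕜 σ Y c β := by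
  obtain ⟨π, ξ, hξ, hc⟩ := h
  refine ⟨conjRep Φ π, fun e => Φ (ξ e), fun g e => ?_, fun s k hk => ?_⟩
  · simp [conjRep, hξ]
  · refine (hc s k hk).trans_eq ?_
    rw [← Φ.norm_map, map_sum]
    simp only [map_smul]

theorem coeFn_sum_smul_toLp {p : ℝ≥0∞} {Ω : Type*} [MeasurableSpace Ω] {μ : Measure Ω} {f : E → Ω → 𝕜}
    (hf : ∀ e, MemLp (f e) p μ) (s : Finset E) (k : E → 𝕜) :
    (∑ e ∈ s, k e • (hf e).toLp : Lp 𝕜 p μ) =ᵐ[μ] fun x => ∑ e ∈ s, k e * f e x := by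
  have h1 := Lp.coeFn_fun_finsetSum s fun e => k e • (hf e).toLp
  have h2 : ∀ᵐ x ∂μ, ∀ e ∈ s, (k e • (hf e).toLp : Lp 𝕜 p μ) x = k e * f e x := by
    rw [Filter.eventually_all_finset]
    intro e _
    filter_upwards [Lp.coeFn_smul (k e) (hf e).toLp, (hf e).coeFn_toLp] with x h3 h4
    rw [h3, Pi.smul_apply, h4, smul_eq_mul]
  filter_upwards [h1, h2] with x h1 h2
  rw [h1]
  exact Finset.sum_congr rfl h2

open Classical in
/-- The unit vectors of `ℓ_p(E)`, realised as disjointly supported functions in `L_p([0, 1])`. -/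
theorem hasPermutedFamily_disjoint [Countable E] [Nonempty E] (hp : p ≠ ∞)
    (σ : G →* Equiv.Perm E) :
    HasPermutedFamily 𝕜 σ (Lp 𝕜 p (volume : Measure unitInterval)) 1 (p.toReal)⁻¹ := by
  let _ : MeasurableSpace E := ⊤
  have hp0 : p ≠ 0 := (one_pos.trans_le (Fact.out : 1 ≤ p)).ne'
  have h0 : 0 < p.toReal := ENNReal.toReal_pos hp0 hp
  -- The interval factor only serves to remove the atoms of counting measure.
  let μ : Measure (E × unitInterval) := Measure.count.prod volume
  have hnull : NullSingletonClass μ := ⟨fun ⟨e, t⟩ => by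
    rw [← Set.singleton_prod_singleton, Measure.prod_prod, measure_singleton (μ := volume) t, mul_zero]⟩
  have hμE : ∀ s : Finset E, μ ((s : Set E) ×ˢ Set.univ) = s.card := fun s => by
    rw [Measure.prod_prod, Measure.count_apply_finset, measure_univ, mul_one]
  have hμ0 : μ ≠ 0 := fun h => by
    obtain ⟨e⟩ := ‹Nonempty E›
    have := hμE {e}
    simp [h] at this
  obtain ⟨Φ⟩ := nonempty_lpEquiv_unitInterval (𝕜 := 𝕜) (p := p) hp μ hμ0
  refine HasPermutedFamily.of_equiv ?_ Φ
  let τ : G → E × unitInterval → E × unitInterval := fun g z => (σ g z.1, z.2)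
  have τ_one : τ 1 = id := by ext1 z; simp [τ]
  have τ_mul : ∀ g h, τ (g * h) = τ g ∘ τ h := fun g h => by ext1 z; simp [τ]
  have hcount : ∀ g, MeasurePreserving (σ g) (Measure.count : Measure E) Measure.count := fun g => by
    refine ⟨measurable_from_top, Measure.ext fun s hs => ?_⟩
    rw [Measure.map_apply measurable_from_top hs, Measure.count_apply (measurable_from_top hs),
      Measure.count_apply hs, ← Equiv.image_symm_eq_preimage,
      (Equiv.injective _).encard_image]
  have hτ : ∀ g, MeasurePreserving (τ g) μ μ := fun g =>
    (hcount g).prod (MeasurePreserving.id volume)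
  let f : E → E × unitInterval → 𝕜 := fun e => (({e} : Set E) ×ˢ Set.univ).indicator fun _ => 1
  have hmeas : ∀ s : Set E, MeasurableSet (s ×ˢ (Set.univ : Set unitInterval)) := fun s =>
    (MeasurableSpace.measurableSet_top (s := s)).prod MeasurableSet.univ
  have hf : ∀ e, MemLp (f e) p μ := fun e =>
    memLp_indicator_const p (hmeas {e}) 1 (Or.inr (by
      have := hμE {e}
      rw [Finset.coe_singleton] at this
      rw [this]; simp))
  refine ⟨koopman 𝕜 p τ hτ τ_one τ_mul, fun e => (hf e).toLp, fun g e => ?_, fun s k hk => ?_⟩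
  · refine koopman_toLp τ hτ τ_one τ_mul g (hf e) (hf (σ g e)) fun z => ?_
    have h1 : (τ g⁻¹ z).1 = e ↔ z.1 = σ g e := by
      change σ g⁻¹ z.1 = e ↔ _
      rw [map_inv, Equiv.Perm.inv_eq_iff_eq]
    simp only [f, Set.indicator_apply, Set.mem_prod, Set.mem_singleton_iff, Set.mem_univ,
      and_true, h1]
  · have hnorm : ‖∑ e ∈ s, (k e : 𝕜) • (hf e).toLp‖ ^ p.toReal = s.card := by
      rw [Lp_norm_rpow_eq_integral hp0 hp]
      have : ∀ᵐ z ∂μ, ‖(∑ e ∈ s, (k e : 𝕜) • (hf e).toLp : Lp 𝕜 p μ) z‖ ^ p.toReal =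
          ((s : Set E) ×ˢ Set.univ).indicator (fun _ => (1 : ℝ)) z := by
        filter_upwards [coeFn_sum_smul_toLp hf s fun e => (k e : 𝕜)] with z hz
        rw [hz]
        have h1 : ∀ e, (k e : 𝕜) * f e z = if z.1 = e then (k e : 𝕜) else 0 := fun e => by
          simp [f, Set.indicator_apply]
        simp only [h1, Finset.sum_ite_eq]
        by_cases hzs : z.1 ∈ s
        · have h2 : |k z.1| = 1 := by
            rw [← sq_eq_sq₀ (abs_nonneg _) zero_le_one, sq_abs, hk _ hzs, one_pow]
          simp [hzs, h2]
        · simp [hzs, Real.zero_rpow h0.ne']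
      rw [integral_congr_ae this, integral_indicator_const _ (hmeas _), measureReal_def, hμE]
      simp
    rw [one_mul, ← hnorm, ← Real.rpow_mul (norm_nonneg _), mul_inv_cancel₀ h0.ne', Real.rpow_one]

-- Zero variance would concentrate Lebesgue measure on a single point.
open ProbabilityTheory in
theorem variance_coe_unitInterval_pos :
    0 < Var[fun t : unitInterval => (t : ℝ); (volume : Measure unitInterval)] := by
  have hX : MemLp (fun t : unitInterval => (t : ℝ)) 2 volume :=
    MemLp.of_bound (by fun_prop) 1 (Filter.Eventually.of_forall fun t => by
      rw [Real.norm_of_nonneg t.2.1]; exact t.2.2)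
  refine (variance_nonneg _ _).lt_of_ne fun h => ?_
  have h1 := (evariance_eq_zero_iff hX.aemeasurable).mp (by
    rw [← ofReal_variance hX, ← h, ENNReal.ofReal_zero])
  set m := ∫ t : unitInterval, (t : ℝ)
  have h2 : ∀ᵐ t : unitInterval, t ∈ {t : unitInterval | (t : ℝ) = m} := h1
  have h3 : ({t : unitInterval | (t : ℝ) = m}).Subsingleton := fun a ha b hb =>
    Subtype.ext (ha.trans hb.symm)
  have h4 := prob_compl_eq_zero_iff₀
    (h3.measurableSet.nullMeasurableSet (μ := (volume : Measure unitInterval))) |>.mp h2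
  rw [h3.measure_zero] at h4
  exact zero_ne_one h4

open ProbabilityTheory in
/-- Independent identically distributed random variables indexed by `E`, realised in
`L_p([0, 1])`. -/
theorem exists_hasPermutedFamily_independent [Countable E] [Nonempty E] (hp : p ≠ ∞) (hp2 : 2 ≤ p)
    (σ : G →* Equiv.Perm E) :
    ∃ c : ℝ, 0 < c ∧
      HasPermutedFamily 𝕜 σ (Lp 𝕜 p (volume : Measure unitInterval)) c (1 / 2) := by
  set v := Var[fun t : unitInterval => (t : ℝ); (volume : Measure unitInterval)] with hv
  have hv0 : 0 < v := variance_coe_unitInterval_pos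
  refine ⟨v ^ (1 / 2 : ℝ), by positivity, ?_⟩
  let μ : Measure (E → unitInterval) := Measure.infinitePi fun _ => volume
  have heval : ∀ e : E, MeasurePreserving (Function.eval e) μ volume := fun e =>
    measurePreserving_eval_infinitePi (fun _ : E => (volume : Measure unitInterval)) e
  have hnull : NullSingletonClass μ := ⟨fun ω => by
    obtain ⟨e⟩ := ‹Nonempty E›
    refine measure_mono_null (t := Function.eval e ⁻¹' {ω e}) (by simp) ?_
    rw [(heval e).measure_preimage (MeasurableSet.singleton _).nullMeasurableSet,
      measure_singleton]⟩
  obtain ⟨Φ⟩ := nonempty_lpEquiv_unitInterval (𝕜 := 𝕜) (p := p) hp μ (IsProbabilityMeasure.ne_zero μ)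
  refine HasPermutedFamily.of_equiv ?_ Φ
  let τ : G → (E → unitInterval) → E → unitInterval := fun g ω e => ω ((σ g)⁻¹ e)
  have τ_one : τ 1 = id := by ext1 ω; simp [τ]; rfl
  have τ_mul : ∀ g h, τ (g * h) = τ g ∘ τ h := fun g h => by
    ext1 ω; simp [τ]; rfl
  have hτ : ∀ g, MeasurePreserving (τ g) μ μ := fun g => by
    have h1 := Measure.infinitePi_map_piCongrLeft (fun _ : E => (volume : Measure unitInterval))
      (σ g)
    have h2 : (MeasurableEquiv.piCongrLeft (fun _ : E => unitInterval) (σ g) :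
        (E → unitInterval) → E → unitInterval) = τ g := by
      ext1 ω
      funext e
      obtain ⟨e', rfl⟩ := (σ g).surjective e
      rw [MeasurableEquiv.coe_piCongrLeft, Equiv.piCongrLeft_apply_apply]
      exact congrArg ω ((σ g).symm_apply_apply e').symm
    rw [h2] at h1
    refine ⟨?_, h1⟩
    exact measurable_pi_lambda _ fun e => measurable_pi_apply _
  have hbound : ∀ (e : E) (ω : E → unitInterval), ‖(ω e : ℝ)‖ ≤ 1 := fun e ω => by
    rw [Real.norm_of_nonneg (ω e).2.1]; exact (ω e).2.2
  have hcoe : ∀ e : E, Measurable fun ω : E → unitInterval => (ω e : ℝ) := fun e =>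
    measurable_subtype_coe.comp (measurable_pi_apply e)
  let f : E → (E → unitInterval) → 𝕜 := fun e ω => ((ω e : ℝ) : 𝕜)
  have hf : ∀ e, MemLp (f e) p μ := fun e =>
    MemLp.of_bound (RCLike.continuous_ofReal.measurable.comp (hcoe e)).aestronglyMeasurable 1
      (Filter.Eventually.of_forall fun ω => by
      rw [RCLike.norm_ofReal]; exact hbound e ω)
  refine ⟨koopman 𝕜 p τ hτ τ_one τ_mul, fun e => (hf e).toLp, fun g e => ?_, fun s k hk => ?_⟩
  · refine koopman_toLp τ hτ τ_one τ_mul g (hf e) (hf (σ g e)) fun ω => ?_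
    change ((ω ((σ g⁻¹)⁻¹ e) : ℝ) : 𝕜) = ((ω (σ g e) : ℝ) : 𝕜)
    rw [map_inv, inv_inv]
  · let Y : E → (E → unitInterval) → ℝ := fun e ω => k e * (ω e : ℝ)
    have hY : ∀ e, MemLp (Y e) 2 μ := fun e =>
      (MemLp.of_bound (hcoe e).aestronglyMeasurable 1 (Filter.Eventually.of_forall (hbound e))).const_mul (k e)
    have hYvar : ∀ e ∈ s, Var[Y e; μ] = v := fun e he => by
      rw [variance_const_mul, hk e he, one_mul]
      refine IdentDistrib.variance_eq (f := fun ω : E → unitInterval => (ω e : ℝ))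
        (g := fun t : unitInterval => (t : ℝ)) ⟨(hcoe e).aemeasurable,
          measurable_subtype_coe.aemeasurable, ?_⟩
      rw [← (heval e).map_eq, Measure.map_map measurable_subtype_coe (measurable_pi_apply e)]
      rfl
    have hind : iIndepFun Y μ :=
      iIndepFun_infinitePi (P := fun _ : E => (volume : Measure unitInterval))
        (X := fun e t => k e * (t : ℝ)) fun e => measurable_subtype_coe.const_mul _
    have hsum : Var[∑ e ∈ s, Y e; μ] = s.card * v := by
      rw [IndepFun.variance_sum (fun e _ => hY e) fun e _ e' _ h => hind.indepFun h,
        Finset.sum_congr rfl hYvar, Finset.sum_const, nsmul_eq_mul]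
    have hYs : MemLp (∑ e ∈ s, Y e) 2 μ := memLp_finsetSum' s fun e _ => hY e
    -- Centring is not needed: the second moment dominates the variance, which is additive by
    -- independence, and the signs do not affect it.
    have h2 : s.card * v ≤ ‖hYs.toLp‖ ^ 2 := by
      have h3 := Lp_norm_rpow_eq_integral two_ne_zero ENNReal.ofNat_ne_top hYs.toLp
      simp only [ENNReal.toReal_ofNat, Real.rpow_two] at h3
      rw [h3, ← hsum]
      refine (variance_le_expectation_sq hYs.aestronglyMeasurable).trans_eq (integral_congr_ae ?_)
      filter_upwards [hYs.coeFn_toLp] with ω hω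
      rw [hω, Real.norm_eq_abs, sq_abs]
      rfl
    -- On a probability space the `L_2` norm is at most the `L_p` norm for `p ≥ 2`.
    have h4 : ‖hYs.toLp‖ ≤ ‖∑ e ∈ s, (k e : 𝕜) • (hf e).toLp‖ := by
      rw [Lp.norm_def, Lp.norm_def]
      refine ENNReal.toReal_mono (Lp.eLpNorm_ne_top _) ?_
      refine le_trans ?_ (eLpNorm_le_eLpNorm_of_exponent_le hp2 (Lp.aestronglyMeasurable _))
      refine (eLpNorm_congr_norm_ae ?_).le
      filter_upwards [hYs.coeFn_toLp, coeFn_sum_smul_toLp hf s fun e => (k e : 𝕜)] with ω h5 h6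
      rw [h5, h6, Finset.sum_apply, ← norm_algebraMap' 𝕜 (∑ e ∈ s, Y e ω)]
      simp [Y, f]
    have h7 : (v ^ (1 / 2 : ℝ) * (s.card : ℝ) ^ (1 / 2 : ℝ)) ^ 2 ≤ ‖hYs.toLp‖ ^ 2 := by
      rw [← Real.mul_rpow hv0.le (by positivity), ← Real.sqrt_eq_rpow, Real.sq_sqrt (by positivity)]
      linarith
    exact (pow_le_pow_iff_left₀ (by positivity) (norm_nonneg _) two_ne_zero |>.mp h7).trans h4

end Models

/-! ### The compression of the free group from below. -/

section LowerBound

open FreeGroup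

theorem IsOneCocycle.exists_norm_le {𝕜 : Type*} [RCLike 𝕜] {G : Type*} [Group G] {X : Type*}
    [NormedAddCommGroup X] [NormedSpace 𝕜 X] {π : G →* (X ≃ₗᵢ[𝕜] X)} {b : G → X}
    (hb : IsOneCocycle 𝕜 π b) {S : Set G} (hS : IsSymmGenSet S) :
    ∃ L : ℝ, ∀ g, ‖b g‖ ≤ L * wordLength S g := by
  refine ⟨∑ s ∈ hS.finite.toFinset, ‖b s‖, fun g => ?_⟩
  obtain ⟨l, hl, rfl, hlen⟩ := hS.exists_list g
  rw [← hlen]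
  clear hlen
  induction l with
  | nil => simp [hb.map_one]
  | cons s l ih =>
    rw [List.prod_cons, hb, List.length_cons]
    have h1 : ‖b s‖ ≤ ∑ s ∈ hS.finite.toFinset, ‖b s‖ :=
      Finset.single_le_sum (f := fun s => ‖b s‖) (fun _ _ => norm_nonneg _)
        (by simpa using hl s (by simp))
    have h2 := ih fun t ht => hl t (by simp [ht])
    refine (norm_add_le _ _).trans ?_
    rw [LinearIsometryEquiv.norm_map]
    push_cast
    linarith

theorem IsSymmGenSet.wordLength_mul_le {G : Type*} [Group G] {S : Set G} (hS : IsSymmGenSet S)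
    (g h : G) : wordLength S (g * h) ≤ wordLength S g + wordLength S h := by
  obtain ⟨l, hl, hlg, hlen⟩ := hS.exists_list g
  obtain ⟨l', hl', hlh, hlen'⟩ := hS.exists_list h
  rw [← hlen, ← hlen', ← List.length_append, ← hlg, ← hlh, ← List.prod_append]
  refine wordLength_le fun s hs => ?_
  rcases List.mem_append.mp hs with h | h
  exacts [hl s h, hl' s h]

variable {α : Type*} [DecidableEq α] {𝕜 : Type*} [RCLike 𝕜]

/-- The action of a free group on the edges of its Cayley graph. -/
def edgePerm : FreeGroup α →* Equiv.Perm (FreeGroup α × α) where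
  toFun g := (Equiv.mulLeft g).prodCongr (Equiv.refl α)
  map_one' := by ext e <;> simp
  map_mul' g h := by ext e <;> simp [mul_assoc]

variable {X : Type*} [NormedAddCommGroup X] [NormedSpace 𝕜 X]

theorem isOneCocycle_treeCocycle {π : FreeGroup α →* (X ≃ₗᵢ[𝕜] X)} {ξ : FreeGroup α × α → X}
    (hξ : ∀ g e, π g (ξ e) = ξ (edgePerm g e)) :
    IsOneCocycle 𝕜 π fun x => ∑ᶠ e, ((treeCocycle x e : ℝ) : 𝕜) • ξ e := by
  have hfin : ∀ x, (Function.support fun e => ((treeCocycle x e : ℝ) : 𝕜) • ξ e).Finite :=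
    fun x => (treeCocycle_support_finite x).subset fun e he h => he (by simp [h])
  intro x y
  have h1 : π x (∑ᶠ e, ((treeCocycle y e : ℝ) : 𝕜) • ξ e) =
      ∑ᶠ e, ((treeCocycle y (x⁻¹ * e.1, e.2) : ℝ) : 𝕜) • ξ e := by
    have h2 := AddMonoidHom.map_finsum (π x).toLinearEquiv.toAddEquiv.toAddMonoidHom (hfin y)
    refine h2.trans ?_
    refine Eq.trans (finsum_congr fun e => ?_) (finsum_comp_equiv (edgePerm x)
      (f := fun e => ((treeCocycle y (x⁻¹ * e.1, e.2) : ℝ) : 𝕜) • ξ e))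
    have : ((x⁻¹ * (edgePerm x e).1, (edgePerm x e).2) : FreeGroup α × α) = e := by
      simp [edgePerm]
    rw [this, ← hξ]
    exact map_smul (π x) _ _
  change _ = π x (∑ᶠ e, ((treeCocycle y e : ℝ) : 𝕜) • ξ e) + _
  rw [h1, ← finsum_add_distrib _ (hfin x)]
  · refine finsum_congr fun e => ?_
    rw [treeCocycle_mul, ← add_smul]
    push_cast
    rfl
  · refine ((treeCocycle_support_finite y).image (edgePerm x)).subset fun e he => ?_
    refine ⟨(x⁻¹ * e.1, e.2), fun h => he ?_, by simp [edgePerm]⟩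
    simp [h]

theorem exists_wordLength_le_norm [Finite α] {G : Type*} [Group G] (φ : G ≃* FreeGroup α)
    {S : Set G} (hS : IsSymmGenSet S) :
    ∃ C : ℝ, 0 < C ∧ ∀ g, (wordLength S g : ℝ) ≤ C * (φ g).norm := by
  have := Fintype.ofFinite α
  -- The summand `1` only makes the constant positive.
  refine ⟨1 + ∑ s : α × Bool, (wordLength S (φ.symm (mk [s])) : ℝ), by positivity, fun g => ?_⟩
  have key : ∀ L : List (α × Bool), (wordLength S (φ.symm (mk L)) : ℝ) ≤
      (1 + ∑ s : α × Bool, (wordLength S (φ.symm (mk [s])) : ℝ)) * L.length := by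
    intro L
    induction L with
    | nil =>
      have h1 : φ.symm (mk []) = 1 := map_one φ.symm
      have h2 : wordLength S (1 : G) = 0 := by
        simpa using wordLength_le (S := S) (l := []) (by simp)
      simp [h1, h2]
    | cons s L ih =>
      have h1 : φ.symm (mk (s :: L)) = φ.symm (mk [s]) * φ.symm (mk L) := by
        rw [← _root_.map_mul, mul_mk]; rfl
      have h2 : (wordLength S (φ.symm (mk (s :: L))) : ℝ) ≤
          wordLength S (φ.symm (mk [s])) + wordLength S (φ.symm (mk L)) := by
        rw [h1]; exact_mod_cast hS.wordLength_mul_le _ _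
      have h3 : (wordLength S (φ.symm (mk [s])) : ℝ) ≤
          ∑ s : α × Bool, (wordLength S (φ.symm (mk [s])) : ℝ) :=
        Finset.single_le_sum (f := fun s => (wordLength S (φ.symm (mk [s])) : ℝ))
          (fun _ _ => by positivity) (Finset.mem_univ s)
      rw [List.length_cons]
      push_cast
      linarith
  simpa [mk_toWord, FreeGroup.norm] using key (φ g).toWord

/-- A permuted family indexed by the edges of the Cayley tree yields a lower bound for the
compression of the free group. -/
theorem HasPermutedFamily.hasEquivariantCompression [Finite α] {G : Type*} [Group G]
    (φ : G ≃* FreeGroup α) {S : Set G} (hS : IsSymmGenSet S) {c : ℝ} (hc : 0 < c) {β : ℝ≥0}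
    (h : HasPermutedFamily 𝕜 (edgePerm (α := α)) X c β) :
    HasEquivariantCompression 𝕜 X S β := by
  obtain ⟨π, ξ, hξ, hlow⟩ := h
  set f : FreeGroup α → X := fun x => ∑ᶠ e, ((treeCocycle x e : ℝ) : 𝕜) • ξ e with hf
  have hcocycle : IsOneCocycle 𝕜 π f := isOneCocycle_treeCocycle hξ
  set b : G → X := fun g => f (φ g) with hb
  have hbc : IsOneCocycle 𝕜 (π.comp φ.toMonoidHom) b := fun x y => by
    simp only [hb, _root_.map_mul]
    exact hcocycle (φ x) (φ y)
  have hdist : ∀ x y, ‖b x - b y‖ = ‖b (x⁻¹ * y)‖ := fun x y => by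
    have h1 := hbc x (x⁻¹ * y)
    rw [mul_inv_cancel_left] at h1
    rw [h1, norm_sub_rev, add_sub_cancel_right, LinearIsometryEquiv.norm_map]
  have hfnorm : ∀ x : FreeGroup α, c * (x.norm : ℝ) ^ (β : ℝ) ≤ ‖f x‖ := fun x => by
    have h1 : f x = ∑ e ∈ treePath x, ((treeCocycle x e : ℝ) : 𝕜) • ξ e := by
      refine finsum_eq_sum_of_support_subset _ fun e he => ?_
      rw [Finset.mem_coe, mem_treePath]
      exact fun h => he (by simp [h])
    rw [h1, ← card_treePath]
    refine hlow _ _ fun e he => ?_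
    have h2 := mem_treePath.mp he
    rcases treeCocycle_mem x e with h | h | h
    · simp [h]
    · exact absurd h h2
    · simp [h]
  obtain ⟨L, hL⟩ := hbc.exists_norm_le hS
  obtain ⟨C, hC0, hC⟩ := exists_wordLength_le_norm φ hS
  -- The cocycle is the orbit map of `0`, and any cocycle is Lipschitz.
  refine ⟨b, ⟨π.comp φ.toMonoidHom, b, 0, hbc, fun x => by simp⟩,
    ⟨L, fun x y => (hdist x y).trans_le (hL _)⟩, c / C ^ (β : ℝ), by positivity,
    fun x y _ => ?_⟩
  rw [hdist]
  refine le_trans ?_ (hfnorm (φ (x⁻¹ * y)))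
  calc c / C ^ (β : ℝ) * (wordDist S x y : ℝ) ^ (β : ℝ)
      ≤ c / C ^ (β : ℝ) * (C * (φ (x⁻¹ * y)).norm) ^ (β : ℝ) := by
        gcongr
        exact hC _
    _ = _ := by
        rw [Real.mul_rpow hC0.le (by positivity)]
        field_simp

theorem le_lpEquivariantCompressionExponent [Finite α] [Nonempty α] {p : ℝ≥0∞}
    [hp1 : Fact (1 ≤ p)] (hp : p ≠ ∞) {G : Type*} [Group G] (φ : G ≃* FreeGroup α) {S : Set G}
    (hS : IsSymmGenSet S) :
    max (1 / 2) (1 / p) ≤ lpEquivariantCompressionExponent 𝕜 p S := by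
  have hp0 : p ≠ 0 := (one_pos.trans_le hp1.out).ne'
  have hcount : Countable (FreeGroup α) := by
    refine Function.Injective.countable (toWord_injective (α := α))
  have hle : ∀ β : ℝ≥0, HasEquivariantCompression 𝕜 (Lp 𝕜 p (volume : Measure unitInterval)) S β →
      (β : ℝ≥0∞) ≤ lpEquivariantCompressionExponent 𝕜 p S := fun β hβ =>
    le_iSup₂ (f := fun (β : ℝ≥0) (_ : HasEquivariantCompression 𝕜
      (Lp 𝕜 p (volume : Measure unitInterval)) S β) => (β : ℝ≥0∞)) β hβ
  rcases le_total p 2 with hp2 | hp2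
  · have hmax : max (1 / 2) (1 / p) = (((p.toNNReal)⁻¹ : ℝ≥0) : ℝ≥0∞) := by
      rw [max_eq_right (by gcongr), one_div, ENNReal.coe_inv (ENNReal.toNNReal_ne_zero.mpr ⟨hp0, hp⟩),
        ENNReal.coe_toNNReal hp]
    rw [hmax]
    refine hle _ (HasPermutedFamily.hasEquivariantCompression φ hS one_pos ?_)
    exact hasPermutedFamily_disjoint hp edgePerm
  · have hmax : max (1 / 2) (1 / p) = (((1 / 2 : ℝ≥0)) : ℝ≥0∞) := by
      rw [max_eq_left (by gcongr)]
      simp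
    rw [hmax]
    obtain ⟨c, hc, h⟩ := exists_hasPermutedFamily_independent (𝕜 := 𝕜) hp hp2 (edgePerm (α := α))
    refine hle _ (HasPermutedFamily.hasEquivariantCompression φ hS hc ?_)
    simpa using h

end LowerBound

/-! ### Assembly of the theorem. -/

theorem isSymmGenSet_exists (G : Type*) [Group G] [hG : Group.FG G] :
    ∃ S : Set G, IsSymmGenSet S := by
  obtain ⟨S, hS, hfin⟩ := (Group.fg_iff).mp hG
  refine ⟨S ∪ S⁻¹, hfin.union hfin.inv, fun s hs => ?_, ?_⟩
  · rcases hs with h | h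
    · exact Or.inr (by simpa using h)
    · exact Or.inl h
  · rw [eq_top_iff, ← hS]
    exact Subgroup.closure_mono Set.subset_union_left

end Compression

theorem mainTheorem9 {𝕜 : Type*} [RCLike 𝕜] (p : ℝ≥0∞) [Fact (1 ≤ p)] (hp : p ≠ ∞) :
    (∀ S : Set (FreeGroup (Fin 2)), Compression.IsSymmGenSet S →
      Compression.lpEquivariantCompressionExponent 𝕜 p S = max (1 / 2) (1 / p)) ∧
    ¬ Compression.IsAmenable (FreeGroup (Fin 2)) ∧
    (2 ≤ p →
      IsLeast {t : ℝ≥0∞ | ∀ (G : Type*) [Group G] (S : Set G), Compression.IsSymmGenSet S →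
        t < Compression.lpEquivariantCompressionExponent 𝕜 p S → Compression.IsAmenable G}
        (1 / 2)) := by
  refine ⟨fun S hS => le_antisymm (not_lt.mp fun h => ?_)
    (Compression.le_lpEquivariantCompressionExponent hp (MulEquiv.refl _) hS),
    Compression.not_isAmenable_freeGroup, fun hp2 => ⟨fun G _ S hS h => ?_, fun t ht => ?_⟩⟩
  · exact Compression.not_isAmenable_freeGroup
      (Compression.isAmenable_of_lt_lpEquivariantCompressionExponent hS hp h)
  · refine Compression.isAmenable_of_lt_lpEquivariantCompressionExponent (𝕜 := 𝕜) hS hp ?_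
    rwa [max_eq_left (by gcongr)]
  · by_contra hlt
    rw [not_le] at hlt
    -- The groups in question live in an arbitrary universe, so a lifted copy of the free group is
    -- the counterexample for `t < 1/2`.
    let φ : ULift (FreeGroup (Fin 2)) ≃* FreeGroup (Fin 2) := MulEquiv.ulift
    have hfg : Group.FG (ULift (FreeGroup (Fin 2))) :=
      Group.fg_of_surjective (f := φ.symm.toMonoidHom) φ.symm.surjective
    obtain ⟨S, hS⟩ := Compression.isSymmGenSet_exists (ULift (FreeGroup (Fin 2)))
    refine Compression.not_isAmenable_freeGroup ((ht _ S hS ?_).of_mulEquiv φ)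
    exact hlt.trans_le ((le_max_left _ _).trans
      (Compression.le_lpEquivariantCompressionExponent hp φ hS))
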